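/- Let $\Bbbk$ be a field of characteristic $0$ (for instance $\mathbb C$) and $n\ge 0$. An exp-polynomial function in $r$ variables is an element of the subalgebra of functions $\mathbb Z^r\to\Bbbk$ generated by $n_j$ and $a^{n_j}$ ($a\in\Bbbk\setminus\{0\}$, $1\le j\le r$). Let $G=\bigoplus_{\alpha\in\mathbb Z^n}G_\alpha$ be a $\mathbb Z^n$-graded Lie algebra over $\Bbbk$ that is exp-polynomial: it has a spanning set $\{g_k(\alpha)\mid k\in K,\ \alpha\in\mathbb Z^n\}$ with $g_k(\alpha)\in G_\alpha$, and exp-polynomial functions $f_{k,r}^s$ in $2n$ variables ($k,r,s\in K$), where for all $k,r$ only finitely many $f_{k,r}^s$ are nonzero, such that $$[g_k(\alpha),g_r(\beta)]=\sum_{s\in K}f_{k,r}^s(\alpha,\beta)\,g_s(\alpha+\beta)\qquad(k,r\in K,\ \alpha,\beta\in\mathbb Z^n).$$ Assume that $G$ is $\mathbb Z^n$-extragraded: $G$ has a second grading $G=\bigoplus_{i\in\mathbb Z}G^{(i)}$ as a Lie algebra, and $K$ is a disjoint union of finite subsets $K_i$ ($i\in\mathbb Z$) such that the $g_k(\alpha)$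 with $k\in K_i$, $\alpha\in\mathbb Z^n$ lie in $G^{(i)}$ and span it. Put $G^{+}=\bigoplus_{i\ge 1}G^{(i)}$. Let $V$ be a finite-dimensional exp-polynomial $G^{(0)}$-module, that is, a $G^{(0)}$-module with a finite basis $\{v_j\}_{j\in J}$ and exp-polynomial functions $h_{k,j}^s$ in $n$ variables ($k\in K_0$; $j,s\in J$) such that $g_k(\alpha)v_j=\sum_{s\in J}h_{k,j}^s(\alpha)v_s$ for all $k\in K_0$, $\alpha\in\mathbb Z^n$, $j\in J$. Let $G^+$ act on $V$ by zero, and let $\widetilde M(V)=U(G)\otimes_{U(G^{(0)}+G^+)}V$ be the induced $G$-module, $\mathbb Z$-graded by the grading of $U(G)$ induced from $G=\bigoplus_i G^{(i)}$, with $V$ in degree $0$. Let $\widetilde M^{\mathrm{rad}}$ be the largest $\mathbb Z$-graded $G$-submodule of $\widetilde M(V)$ that intersects $V$ trivially (the sum of all such submodules), and let $M(V)=\widetilde M(V)/\widetilde M^{\mathrm{rad}}$, with $M(V)^{(i)}$ the image of $\widetilde M(V)^{(i)}$. **Theorem.** The subspaces $M(V)^{(i)}$, $i\in\mathbb Z$,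 make $M(V)$ a $\mathbb Z$-graded $G$-module with finite-dimensional homogeneous spaces: $M(V)=\bigoplus_{i\in\mathbb Z}M(V)^{(i)}$, $G^{(i)}M(V)^{(j)}\subseteq M(V)^{(i+j)}$ for all $i,j\in\mathbb Z$, and $\dim M(V)^{(i)}<\infty$ for every $i\in\mathbb Z$. -/

import Mathlib

open scoped TensorProduct

/-- The algebra of exp-polynomial functions `ℤ^σ → 𝕜` in the variables `n_j`, `j ∈ σ`: the
subalgebra of all functions generated by the functions `n_j` and `a ^ n_j`, `a ∈ 𝕜 \ {0}`. -/
def expPolynomial (𝕜 : Type*) [Field 𝕜] (σ : Type*) : Subalgebra 𝕜 ((σ → ℤ) → 𝕜) :=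
  Algebra.adjoin 𝕜
    ({f | ∃ j : σ, f = fun n => ((n j : ℤ) : 𝕜)} ∪
      {f | ∃ (j : σ) (a : 𝕜), a ≠ 0 ∧ f = fun n => a ^ (n j)})

/-- A grading of the Lie algebra `G` by the additive group `ι`: a direct sum decomposition into
subspaces `G_i` with `[G_i, G_j] ⊆ G_{i+j}`. -/
structure LieGrading (𝕜 : Type*) (G : Type*) (ι : Type*) [Field 𝕜] [LieRing G]
    [LieAlgebra 𝕜 G] [AddCommGroup ι] [DecidableEq ι] where
  /-- the homogeneous component of degree `i` -/
  comp : ι → Submodule 𝕜 G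
  isInternal : DirectSum.IsInternal comp
  lie_mem : ∀ {i j : ι} {x y : G}, x ∈ comp i → y ∈ comp j → ⁅x, y⁆ ∈ comp (i + j)

/-- `G`, with the `ℤ^n`-grading `𝒢`, is an exp-polynomial Lie algebra with distinguished spanning
set `g_k(α)`, `k ∈ K`, `α ∈ ℤ^n`.  The family `f k r : K →₀ _` collects the structure functions
`f_{k,r}^s(α, β)`, finitely many of which are nonzero for given `k` and `r`; the `2n` variables
are indexed by `Fin n ⊕ Fin n`. -/
structure IsExpPolynomialLie {𝕜 G K : Type*} [Field 𝕜] [LieRing G] [LieAlgebra 𝕜 G] {n : ℕ}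
    (𝒢 : LieGrading 𝕜 G (Fin n → ℤ)) (g : K → (Fin n → ℤ) → G) : Prop where
  mem_comp : ∀ k α, g k α ∈ 𝒢.comp α
  span_eq_top : Submodule.span 𝕜 {x | ∃ k α, x = g k α} = ⊤
  bracket : ∃ f : K → K → K →₀ expPolynomial 𝕜 (Fin n ⊕ Fin n), ∀ k r α β,
    ⁅g k α, g r β⁆ =
      (f k r).sum fun s h => (h : (Fin n ⊕ Fin n → ℤ) → 𝕜) (Sum.elim α β) • g s (α + β)

/-- The exp-polynomial Lie algebra `G` is `ℤ^n`-extragraded: it has a second grading `𝒵`, by `ℤ`,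
and `K` is the disjoint union of the finite sets `K_i = {k | deg k = i}`, where the `g_k(α)` with
`k ∈ K_i` are homogeneous of degree `i` for `𝒵` and span `G^(i)`. -/
structure IsExtragraded {𝕜 G K : Type*} [Field 𝕜] [LieRing G] [LieAlgebra 𝕜 G] {n : ℕ}
    (𝒢 : LieGrading 𝕜 G (Fin n → ℤ)) (𝒵 : LieGrading 𝕜 G ℤ)
    (deg : K → ℤ) (g : K → (Fin n → ℤ) → G) : Prop
    extends IsExpPolynomialLie 𝒢 g where
  finite_deg : ∀ i : ℤ, {k | deg k = i}.Finite
  mem_deg : ∀ k α, g k α ∈ 𝒵.comp (deg k)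
  span_deg : ∀ i : ℤ, Submodule.span 𝕜 {x | ∃ k α, deg k = i ∧ x = g k α} = 𝒵.comp i

/-- The module `V` over the Lie algebra `L` with distinguished spanning set `g_k(α)` is a
finite-dimensional exp-polynomial module. -/
def IsFiniteExpPolynomialModule (𝕜 : Type*) {L K : Type*} (V : Type*) [Field 𝕜] [LieRing L]
    [LieAlgebra 𝕜 L] [AddCommGroup V] [Module 𝕜 V] [LieRingModule L V] [LieModule 𝕜 L V]
    {n : ℕ} (g : K → (Fin n → ℤ) → L) : Prop :=
  ∃ (d : ℕ) (v : Module.Basis (Fin d) 𝕜 V) (h : K → Fin d → Fin d → expPolynomial 𝕜 (Fin n)),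
    ∀ k α j, ⁅g k α, v j⁆ = ∑ s, (h k j s : (Fin n → ℤ) → 𝕜) α • v s

namespace LieGrading

section

variable {𝕜 G : Type*} [Field 𝕜] [LieRing G] [LieAlgebra 𝕜 G] (𝒵 : LieGrading 𝕜 G ℤ)

/-- The subalgebra `G^(0)`. -/
def zeroPart : LieSubalgebra 𝕜 G :=
  { 𝒵.comp 0 with
    lie_mem' := fun {x y} hx hy => by
      have h := 𝒵.lie_mem (i := 0) (j := 0) hx hy
      rwa [add_zero] at h }

/-- The subalgebra `G^(0) + G^+`, the sum of the `G^(i)` with `i ≥ 0`. -/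
def nonnegPart : LieSubalgebra 𝕜 G :=
  { (⨆ i : {i : ℤ // 0 ≤ i}, 𝒵.comp i) with
    lie_mem' := fun {x y} hx hy => by
      change ⁅x, y⁆ ∈ (⨆ i : {i : ℤ // 0 ≤ i}, 𝒵.comp i)
      change x ∈ (⨆ i : {i : ℤ // 0 ≤ i}, 𝒵.comp i) at hx
      change y ∈ (⨆ i : {i : ℤ // 0 ≤ i}, 𝒵.comp i) at hy
      induction hx using Submodule.iSup_induction' with
      | zero => rw [zero_lie]; exact zero_mem _
      | add a b _ _ ha hb => rw [add_lie]; exact add_mem ha hb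
      | mem i a ha =>
        induction hy using Submodule.iSup_induction' with
        | zero => rw [lie_zero]; exact zero_mem _
        | add c d _ _ hc hd => rw [lie_add]; exact add_mem hc hd
        | mem j c hc =>
          exact Submodule.mem_iSup_of_mem (p := fun i : {i : ℤ // 0 ≤ i} => 𝒵.comp i)
            ⟨i.1 + j.1, add_nonneg i.2 j.2⟩ (𝒵.lie_mem ha hc) }

/-- The projection of `G` onto the homogeneous component `G^(i)`. -/
noncomputable def proj (i : ℤ) : G →ₗ[𝕜] 𝒵.comp i :=
  DirectSum.component 𝕜 ℤ (fun i => 𝒵.comp i) i ∘ₗ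
    (LinearEquiv.ofBijective (DirectSum.coeLinearMap 𝒵.comp) 𝒵.isInternal).symm.toLinearMap

lemma proj_of_mem {i : ℤ} {x : G} (hx : x ∈ 𝒵.comp i) : 𝒵.proj i x = ⟨x, hx⟩ :=
  𝒵.isInternal.ofBijective_coeLinearMap_of_mem hx

lemma proj_of_mem_ne {i j : ℤ} {x : G} (hx : x ∈ 𝒵.comp j) (h : j ≠ i) : 𝒵.proj i x = 0 :=
  𝒵.isInternal.ofBijective_coeLinearMap_of_mem_ne h hx

/-- The projection `G^(0) + G^+ → G^(0)` along the ideal `G^+`, as a Lie algebra homomorphism. -/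
noncomputable def toZeroPart : 𝒵.nonnegPart →ₗ⁅𝕜⁆ 𝒵.zeroPart :=
  { toFun := fun x => (⟨𝒵.proj 0 (x : G), (𝒵.proj 0 (x : G)).2⟩ : 𝒵.zeroPart)
    map_add' := fun x y => by
      apply Subtype.ext
      simp
    map_smul' := fun c x => by
      apply Subtype.ext
      simp
    map_lie' := fun {x y} => by
      apply Subtype.ext
      obtain ⟨x, hx⟩ := x
      obtain ⟨y, hy⟩ := y
      change ((𝒵.proj 0 ⁅x, y⁆ : 𝒵.comp 0) : G) =
        ⁅((𝒵.proj 0 x : 𝒵.comp 0) : G), ((𝒵.proj 0 y : 𝒵.comp 0) : G)⁆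
      change x ∈ (⨆ i : {i : ℤ // 0 ≤ i}, 𝒵.comp i) at hx
      change y ∈ (⨆ i : {i : ℤ // 0 ≤ i}, 𝒵.comp i) at hy
      induction hx using Submodule.iSup_induction' with
      | zero => simp
      | add a b _ _ ha hb => simp only [add_lie, map_add, Submodule.coe_add, ha, hb]
      | mem i a ha =>
        induction hy using Submodule.iSup_induction' with
        | zero => simp
        | add c d _ _ hc hd => simp only [lie_add, map_add, Submodule.coe_add, hc, hd]
        | mem j c hc =>
          obtain ⟨i, hi⟩ := i
          obtain ⟨j, hj⟩ := j
          change a ∈ 𝒵.comp i at ha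
          change c ∈ 𝒵.comp j at hc
          have hac := 𝒵.lie_mem ha hc
          by_cases hi0 : i = 0
          · subst hi0
            by_cases hj0 : j = 0
            · subst hj0
              rw [add_zero] at hac
              rw [𝒵.proj_of_mem hac, 𝒵.proj_of_mem ha, 𝒵.proj_of_mem hc]
            · rw [𝒵.proj_of_mem_ne hac (by omega), 𝒵.proj_of_mem_ne hc hj0]
              simp
          · rw [𝒵.proj_of_mem_ne hac (by omega), 𝒵.proj_of_mem_ne ha hi0]
            simp }

/-- The `ℤ`-grading of the universal enveloping algebra `U(G)` induced by that of `G`: the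
component of degree `i` is spanned by the products of homogeneous elements of `G` (possibly the
empty product `1`) whose degrees add up to `i`. -/
def envelopingComp (i : ℤ) : Submodule 𝕜 (UniversalEnvelopingAlgebra 𝕜 G) :=
  Submodule.span 𝕜 {u | ∃ l : List (ℤ × G), (∀ p ∈ l, p.2 ∈ 𝒵.comp p.1) ∧
    (l.map Prod.fst).sum = i ∧
    u = (l.map fun p => UniversalEnvelopingAlgebra.ι 𝕜 p.2).prod}

end

end LieGrading

/-- The distinguished spanning set `g_k(α)`, `k ∈ K_0`, of `G^(0)`. -/
def IsExtragraded.zeroFamily {𝕜 G K : Type*} [Field 𝕜] [LieRing G] [LieAlgebra 𝕜 G] {n : ℕ}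
    {𝒢 : LieGrading 𝕜 G (Fin n → ℤ)} {𝒵 : LieGrading 𝕜 G ℤ} {deg : K → ℤ}
    {g : K → (Fin n → ℤ) → G} (hG : IsExtragraded 𝒢 𝒵 deg g) :
    {k : K // deg k = 0} → (Fin n → ℤ) → 𝒵.zeroPart :=
  fun k α => ⟨g k α, by
    have h := hG.mem_deg k α
    rw [k.2] at h
    exact h⟩

section Induced

attribute [local instance] LieRing.ofAssociativeRing

variable {𝕜 G : Type*} [Field 𝕜] [LieRing G] [LieAlgebra 𝕜 G]
  {V : Type*} [AddCommGroup V] [Module 𝕜 V]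

/-- The left `U(G)`-submodule of `U(G) ⊗_𝕜 V` by which one divides to obtain `U(G) ⊗_{U(H)} V`,
for a representation `ρ` on `V` of a subalgebra `H` of `G`.  (`U(H)` is generated by `H`.) -/
def inducedRelations (H : LieSubalgebra 𝕜 G) (ρ : H →ₗ⁅𝕜⁆ Module.End 𝕜 V) :
    Submodule (UniversalEnvelopingAlgebra 𝕜 G) (UniversalEnvelopingAlgebra 𝕜 G ⊗[𝕜] V) :=
  Submodule.span _ {z | ∃ (u : UniversalEnvelopingAlgebra 𝕜 G) (x : H) (v : V),
    z = (u * UniversalEnvelopingAlgebra.ι 𝕜 (x : G)) ⊗ₜ[𝕜] v - u ⊗ₜ[𝕜] (ρ x v)}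

/-- The induced module `Ind_H^G V = U(G) ⊗_{U(H)} V`.  A `G`-module is regarded throughout as a
left module over `U(G)`, on which `x ∈ G` acts as `ι x ∈ U(G)`. -/
abbrev InducedModule (H : LieSubalgebra 𝕜 G) (ρ : H →ₗ⁅𝕜⁆ Module.End 𝕜 V) :=
  (UniversalEnvelopingAlgebra 𝕜 G ⊗[𝕜] V) ⧸ inducedRelations H ρ

end Induced

section GeneralizedVerma

attribute [local instance] LieRing.ofAssociativeRing

variable {𝕜 G : Type*} [Field 𝕜] [LieRing G] [LieAlgebra 𝕜 G] (𝒵 : LieGrading 𝕜 G ℤ)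
  (V : Type*) [AddCommGroup V] [Module 𝕜 V] [LieRingModule 𝒵.zeroPart V]
  [LieModule 𝕜 𝒵.zeroPart V]

/-- The `G^(0)`-module `V` as a representation of `G^(0) + G^+` on which `G^+` acts by zero. -/
noncomputable def inflatedRep : 𝒵.nonnegPart →ₗ⁅𝕜⁆ Module.End 𝕜 V :=
  (LieModule.toEnd 𝕜 𝒵.zeroPart V).comp 𝒵.toZeroPart

/-- `M̃(V)`, the `G`-module induced from the `(G^(0) + G^+)`-module `V`. -/
abbrev MTilde := InducedModule 𝒵.nonnegPart (inflatedRep 𝒵 V)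

/-- The map `V → M̃(V)`, `v ↦ 1 ⊗ v`. -/
noncomputable def toMTilde : V →ₗ[𝕜] MTilde 𝒵 V :=
  ((inducedRelations 𝒵.nonnegPart (inflatedRep 𝒵 V)).mkQ.restrictScalars 𝕜) ∘ₗ
    TensorProduct.mk 𝕜 (UniversalEnvelopingAlgebra 𝕜 G) V 1

/-- The component `M̃(V)^(i)`, spanned by the `u ⊗ v` with `u ∈ U(G)` of degree `i` and `v ∈ V`
(the elements of `V` have degree `0`). -/
noncomputable def MTildeComp (i : ℤ) : Submodule 𝕜 (MTilde 𝒵 V) :=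
  Submodule.span 𝕜 {m | ∃ u ∈ 𝒵.envelopingComp i, ∃ v : V, m = u • toMTilde 𝒵 V v}

/-- The `G`-submodule `N` of `M̃(V)` is graded: it is the sum of its intersections with the
homogeneous components. -/
def IsGradedSubmodule (N : Submodule (UniversalEnvelopingAlgebra 𝕜 G) (MTilde 𝒵 V)) : Prop :=
  N.restrictScalars 𝕜 = ⨆ i : ℤ, N.restrictScalars 𝕜 ⊓ MTildeComp 𝒵 V i

/-- `M̃^rad`, the largest graded submodule of `M̃(V)` which intersects `V` trivially, obtained as
the sum of all of them. -/
noncomputable def MTildeRad : Submodule (UniversalEnvelopingAlgebra 𝕜 G) (MTilde 𝒵 V) :=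
  sSup {N | IsGradedSubmodule 𝒵 V N ∧
    N.restrictScalars 𝕜 ⊓ LinearMap.range (toMTilde 𝒵 V) = ⊥}

/-- `M(V) = M̃(V) / M̃^rad`. -/
abbrev MQuot := MTilde 𝒵 V ⧸ MTildeRad 𝒵 V

/-- The component `M(V)^(i)`, the image of `M̃(V)^(i)`. -/
noncomputable def MQuotComp (i : ℤ) : Submodule 𝕜 (MQuot 𝒵 V) :=
  (MTildeComp 𝒵 V i).map ((MTildeRad 𝒵 V).mkQ.restrictScalars 𝕜)

end GeneralizedVerma

/-- The subspaces `ℳ i` form a `ℤ`-grading of the `G`-module `M`: `M` is their direct sum and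
`G^(i) ℳ_j ⊆ ℳ_{i+j}`. -/
structure IsModuleGrading {𝕜 G : Type*} [Field 𝕜] [LieRing G] [LieAlgebra 𝕜 G]
    (𝒵 : LieGrading 𝕜 G ℤ) {M : Type*} [AddCommGroup M] [Module 𝕜 M]
    [Module (UniversalEnvelopingAlgebra 𝕜 G) M] (ℳ : ℤ → Submodule 𝕜 M) : Prop where
  isInternal : DirectSum.IsInternal ℳ
  smul_mem : ∀ {i j : ℤ} {x : G} {m : M}, x ∈ 𝒵.comp i → m ∈ ℳ j →
    UniversalEnvelopingAlgebra.ι 𝕜 x • m ∈ ℳ (i + j)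

/-!
`M(V)` lives in degrees `≤ 0`.  In negative degree it has no nonzero vector killed by `G^+`: such a
vector would generate a graded submodule missing `V`, and these have been divided out.  Hence a
vector of degree `-i` vanishes as soon as all words of total degree `i` in the `g_k(α)` of positive
degree kill it.

By straightening, the component of degree `-i` is spanned by the words `x` of total degree `-i` in
the `g_k(α)` of negative degree, applied to the images of the `v_j`.  Since the `K_i` are finite,
only finitely many sequences of indices `k` occur, both for these words `x` and for the testing
words `y` of the first paragraph; only the parameters `α` vary.  For fixed sequences of indices,
straightening `y x` shows that `y x v_j` is a combination of the `v_s` whose coefficients are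
exp-polynomial functions of the parameters of `x` and `y` together.  Such a function is a finite sum
of products `a(x) b(y)`, because `c ^ (m + n) = c ^ m c ^ n`.  So the pairing between the words `x`
and the words `y` has finite rank, and the vectors `x v_j` span a finite-dimensional space.
-/

section GradedModules

open DirectSum

lemma isInternal_iff_exists_projections {ι R M : Type*} [DecidableEq ι] [Ring R] [AddCommGroup M]
    [Module R M] {ℳ : ι → Submodule R M} :
    IsInternal ℳ ↔ ⨆ i, ℳ i = ⊤ ∧ ∀ i, ∃ π : Module.End R M,
      (∀ m ∈ ℳ i, π m = m) ∧ ⨆ (j) (_ : j ≠ i), ℳ j ≤ LinearMap.ker π := by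
  refine ⟨fun h => ⟨h.submodule_iSup_eq_top, fun i => ?_⟩, fun ⟨htop, hπ⟩ => ?_⟩
  · let e := (LinearEquiv.ofBijective (coeLinearMap ℳ) h).symm
    exact ⟨(ℳ i).subtype ∘ₗ DirectSum.component R ι (fun i => ℳ i) i ∘ₗ e,
      fun m hm => congrArg Subtype.val (h.ofBijective_coeLinearMap_of_mem hm),
      iSup₂_le fun j hj m hm =>
        congrArg Subtype.val (h.ofBijective_coeLinearMap_of_mem_ne hj hm)⟩
  · refine (isInternal_submodule_iff_iSupIndep_and_iSup_eq_top ℳ).2 ⟨fun i => ?_, htop⟩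
    obtain ⟨π, hπ, hker⟩ := hπ i
    exact Submodule.disjoint_def.2 fun m hm hm' => (hπ m hm).symm.trans (hker hm')

lemma isInternal_map_of_ker_le {ι R M P : Type*} [DecidableEq ι] [Ring R] [AddCommGroup M]
    [Module R M] [AddCommGroup P] [Module R P] {ℳ : ι → Submodule R M} (hℳ : IsInternal ℳ)
    {f : M →ₗ[R] P} (hf : Function.Surjective f)
    (hker : LinearMap.ker f ≤ ⨆ i, LinearMap.ker f ⊓ ℳ i) :
    IsInternal fun i => (ℳ i).map f := by
  obtain ⟨htop, hproj⟩ := isInternal_iff_exists_projections.1 hℳ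
  refine (isInternal_submodule_iff_iSupIndep_and_iSup_eq_top _).2 ⟨fun i => ?_, ?_⟩
  · obtain ⟨π, hπ, hπ'⟩ := hproj i
    have hπker : LinearMap.ker f ≤ (LinearMap.ker f).comap π := by
      refine hker.trans (iSup_le fun j m hm => ?_)
      obtain rfl | hj := eq_or_ne j i
      · simpa [hπ m hm.2] using hm.1
      · have : π m = 0 := hπ' (Submodule.mem_iSup_of_mem j (Submodule.mem_iSup_of_mem hj hm.2))
        simp [this]
    simp only [← Submodule.map_iSup, Submodule.disjoint_def]
    rintro _ ⟨a, ha, rfl⟩ ⟨b, hb, hab⟩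
    have hπab : π (b - a) = -a := by rw [map_sub, hπ a ha, hπ' hb, zero_sub]
    have h : f (-a) = 0 := hπab ▸ hπker (LinearMap.sub_mem_ker_iff.2 hab)
    rwa [map_neg, neg_eq_zero] at h
  · rw [← Submodule.map_iSup, htop, Submodule.map_top, LinearMap.range_eq_top.2 hf]

lemma isInternal_map_mkQ {ι R A M : Type*} [DecidableEq ι] [CommRing R] [Ring A] [Algebra R A]
    [AddCommGroup M] [Module R M] [Module A M] [IsScalarTower R A M] {ℳ : ι → Submodule R M}
    (hℳ : IsInternal ℳ) {N : Submodule A M}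
    (hN : N.restrictScalars R ≤ ⨆ i, N.restrictScalars R ⊓ ℳ i) :
    IsInternal fun i => (ℳ i).map (N.mkQ.restrictScalars R) := by
  have hker : LinearMap.ker (N.mkQ.restrictScalars R) = N.restrictScalars R := by
    rw [LinearMap.ker_restrictScalars, Submodule.ker_mkQ]
  exact isInternal_map_of_ker_le hℳ N.mkQ_surjective (by rwa [hker])

lemma eq_of_le_of_isInternal {ι R M : Type*} [DecidableEq ι] [Ring R] [AddCommGroup M]
    [Module R M] {ℳ 𝒩 : ι → Submodule R M} (hℳ : IsInternal ℳ) (hle : ∀ i, 𝒩 i ≤ ℳ i)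
    (htop : ⨆ i, 𝒩 i = ⊤) : 𝒩 = ℳ := by
  funext i
  refine le_antisymm (hle i) fun m hm => ?_
  obtain ⟨π, hπ, hπ'⟩ := (isInternal_iff_exists_projections.1 hℳ).2 i
  have hrange : ⊤ ≤ (𝒩 i).comap π := by
    rw [← htop]
    refine iSup_le fun j x hx => ?_
    obtain rfl | hj := eq_or_ne j i
    · simpa [hπ x (hle j hx)] using hx
    · have : π x = 0 :=
        hπ' (Submodule.mem_iSup_of_mem j (Submodule.mem_iSup_of_mem hj (hle j hx)))
      simp [this]
  simpa [hπ m hm] using hrange (Submodule.mem_top (x := m))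

lemma span_le_iSup_inf_of_subset {ι κ R A M : Type*} [VAdd ι κ] [CommRing R] [Ring A] [Algebra R A]
    [AddCommGroup M] [Module R M] [Module A M] [IsScalarTower R A M] {𝒜 : ι → Submodule R A}
    (h𝒜 : ⨆ i, 𝒜 i = ⊤) {ℳ : κ → Submodule R M} [SetLike.GradedSMul 𝒜 ℳ] {S : Set M}
    (hS : S ⊆ (⨆ i, (Submodule.span A S).restrictScalars R ⊓ ℳ i : Submodule R M)) :
    (Submodule.span A S).restrictScalars R ≤
      ⨆ i, (Submodule.span A S).restrictScalars R ⊓ ℳ i := by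
  intro m hm
  induction hm using Submodule.span_induction with
  | mem m hm => exact hS hm
  | zero => exact zero_mem _
  | add x y _ _ hx hy => exact add_mem hx hy
  | smul a m hm hm' =>
    have ha : a ∈ ⨆ i, 𝒜 i := h𝒜 ▸ Submodule.mem_top
    induction ha using Submodule.iSup_induction' with
    | zero => rw [zero_smul]; exact zero_mem _
    | add a b _ _ ha hb => rw [add_smul]; exact add_mem ha hb
    | mem i a ha =>
      clear hm
      induction hm' using Submodule.iSup_induction' with
      | zero => rw [smul_zero]; exact zero_mem _
      | add x y _ _ hx hy => rw [smul_add]; exact add_mem hx hy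
      | mem j m hm =>
        exact Submodule.mem_iSup_of_mem (i +ᵥ j)
          ⟨Submodule.smul_mem _ a hm.1, SetLike.GradedSMul.smul_mem ha hm.2⟩

/-- The component `𝒜 i ⊗ V` of `A ⊗ V`, graded by the degree of the first factor. -/
def tensorComp {ι R A : Type*} [CommRing R] [AddCommGroup A] [Module R A] (𝒜 : ι → Submodule R A)
    (V : Type*) [AddCommGroup V] [Module R V] (i : ι) : Submodule R (A ⊗[R] V) :=
  Submodule.map₂ (TensorProduct.mk R A V) (𝒜 i) ⊤

lemma tmul_mem_tensorComp {ι R A V : Type*} [CommRing R] [AddCommGroup A] [Module R A]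
    [AddCommGroup V] [Module R V] {𝒜 : ι → Submodule R A} {i : ι} {a : A} (ha : a ∈ 𝒜 i) (v : V) :
    a ⊗ₜ[R] v ∈ tensorComp 𝒜 V i :=
  Submodule.apply_mem_map₂ (TensorProduct.mk R A V) ha Submodule.mem_top

lemma isInternal_tensorComp {ι R A V : Type*} [DecidableEq ι] [CommRing R] [AddCommGroup A]
    [Module R A] [AddCommGroup V] [Module R V] {𝒜 : ι → Submodule R A} (h𝒜 : IsInternal 𝒜) :
    IsInternal (tensorComp 𝒜 V) := by
  obtain ⟨htop, hproj⟩ := isInternal_iff_exists_projections.1 h𝒜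
  refine isInternal_iff_exists_projections.2 ⟨?_, fun i => ?_⟩
  · simp only [tensorComp]
    rw [← Submodule.map₂_iSup_left, htop, TensorProduct.map₂_mk_top_top_eq_top]
  · obtain ⟨π, hπ, hπ'⟩ := hproj i
    have hid : tensorComp 𝒜 V i ≤ LinearMap.eqLocus (π.rTensor V) LinearMap.id :=
      Submodule.map₂_le.2 fun a ha v _ => by simp [hπ a ha]
    refine ⟨π.rTensor V, fun m hm => hid hm, iSup₂_le fun j hj => ?_⟩
    refine Submodule.map₂_le.2 fun a ha v _ => ?_
    have hπa : π a = 0 := hπ' (Submodule.mem_iSup_of_mem j (Submodule.mem_iSup_of_mem hj ha))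
    simp [hπa]

instance {ι R A V : Type*} [AddMonoid ι] [CommRing R] [Ring A] [Algebra R A] [AddCommGroup V]
    [Module R V] {𝒜 : ι → Submodule R A} [SetLike.GradedMonoid 𝒜] :
    SetLike.GradedSMul 𝒜 (tensorComp 𝒜 V) where
  smul_mem {i j a} m ha hm := by
    have hle : tensorComp 𝒜 V j ≤ (tensorComp 𝒜 V (i + j)).comap (Algebra.lsmul R R _ a) :=
      Submodule.map₂_le.2 fun b hb v _ =>
        tmul_mem_tensorComp (SetLike.mul_mem_graded ha hb) v
    exact hle hm

end GradedModules

section Straightening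

variable {R M : Type*} [Ring R] [AddCommGroup M] [Module R M] {L : ℤ → Set R} {W : AddSubgroup M}

-- The letter `p` is moved to the right end, where it acts on `W`.  Each commutator created on the
-- way leaves a word of the same total degree with one letter less, to which `ih` applies.
lemma prod_smul_mem_of_nonneg_letter
    (hL : ∀ {i j : ℤ} {a b : R}, a ∈ L i → b ∈ L j → a * b - b * a ∈ L (i + j))
    (hzero : ∀ a ∈ L 0, ∀ w ∈ W, a • w ∈ W) (hpos : ∀ i > 0, ∀ a ∈ L i, ∀ w ∈ W, a • w = 0)
    (l₁ l₂ : List (ℤ × R)) {p : ℤ × R} (hp : 0 ≤ p.1)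
    (hl : ∀ q ∈ l₁ ++ p :: l₂, q.2 ∈ L q.1)
    (ih : ∀ l : List (ℤ × R), l.length = (l₁ ++ l₂).length → (∀ q ∈ l, q.2 ∈ L q.1) →
      (l.map Prod.fst).sum = ((l₁ ++ p :: l₂).map Prod.fst).sum →
      ∀ w ∈ W, (l.map Prod.snd).prod • w ∈ W) {w : M} (hw : w ∈ W) :
    ((l₁ ++ p :: l₂).map Prod.snd).prod • w ∈ W := by
  induction l₂ generalizing l₁ with
  | nil =>
    have hpL : p.2 ∈ L p.1 := hl p (by simp)
    rw [List.map_append, List.prod_append, mul_smul, List.map_singleton, List.prod_singleton]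
    obtain hp0 | hp0 := hp.eq_or_lt
    · exact ih l₁ (by simp) (fun q hq => hl q (by simp [hq])) (by simp [← hp0]) _
        (hzero _ (hp0 ▸ hpL) w hw)
    · rw [hpos _ hp0 _ hpL w hw, smul_zero]
      exact zero_mem W
  | cons q l₂ ihl₂ =>
    simp only [List.forall_mem_append, List.forall_mem_cons] at hl
    obtain ⟨hl₁, hpL, hqL, hl₂⟩ := hl
    have hswap : ((l₁ ++ p :: q :: l₂).map Prod.snd).prod =
        (((l₁ ++ [q]) ++ p :: l₂).map Prod.snd).prod +
          ((l₁ ++ (p.1 + q.1, p.2 * q.2 - q.2 * p.2) :: l₂).map Prod.snd).prod := by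
      simp only [List.map_append, List.prod_append, List.map_cons, List.prod_cons, List.map_nil,
        List.prod_nil]
      noncomm_ring
    rw [hswap, add_smul]
    refine add_mem (ihl₂ (l₁ ++ [q]) ?_ ?_) (ih _ ?_ ?_ ?_ w hw)
    · simp only [List.forall_mem_append, List.forall_mem_cons]
      exact ⟨⟨hl₁, hqL, by simp⟩, hpL, hl₂⟩
    · intro l hlen hl hsum
      refine ih l (by simpa using hlen) hl ?_
      rw [hsum]
      simp [add_comm, add_left_comm]
    · simp
    · simp only [List.forall_mem_append, List.forall_mem_cons]
      exact ⟨hl₁, hL hpL hqL, hl₂⟩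
    · simp [add_assoc]

lemma prod_smul_mem_of_sum_nonneg
    (hL : ∀ {i j : ℤ} {a b : R}, a ∈ L i → b ∈ L j → a * b - b * a ∈ L (i + j))
    (hzero : ∀ a ∈ L 0, ∀ w ∈ W, a • w ∈ W) (hpos : ∀ i > 0, ∀ a ∈ L i, ∀ w ∈ W, a • w = 0)
    {l : List (ℤ × R)} (hl : ∀ q ∈ l, q.2 ∈ L q.1) (hsum : 0 ≤ (l.map Prod.fst).sum)
    {w : M} (hw : w ∈ W) : (l.map Prod.snd).prod • w ∈ W := by
  induction h : l.length using Nat.strong_induction_on generalizing l w with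
  | _ N ih =>
  obtain rfl | hne := eq_or_ne l []
  · simpa using hw
  · obtain ⟨p, hpl, hp⟩ := List.exists_le_of_sum_le hne (f := fun _ => (0 : ℤ)) (g := Prod.fst)
      (by simpa using hsum)
    obtain ⟨l₁, l₂, rfl⟩ := List.append_of_mem hpl
    refine prod_smul_mem_of_nonneg_letter hL hzero hpos l₁ l₂ hp hl
      (fun l' hlen hl' hsum' w hw => ih _ ?_ hl' (hsum' ▸ hsum) hw hlen) hw
    simp [← h]

end Straightening

lemma finite_setOf_sum_eq {K : Type*} {d : K → ℤ} (hd : ∀ i, {k | d k = i}.Finite) (i : ℤ) :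
    {κ : List K | (∀ k ∈ κ, 0 < d k) ∧ (κ.map d).sum = i}.Finite := by
  induction h : i.toNat using Nat.strong_induction_on generalizing i with
  | _ N ih =>
    refine ((Set.finite_singleton []).union ((Set.finite_Icc 1 i).biUnion fun j hj =>
      (hd j).image2 List.cons (ih _ ?_ (i - j) rfl))).subset ?_
    · rw [Set.mem_Icc] at hj
      lia
    · rintro (_ | ⟨k, κ⟩) ⟨hκ, rfl⟩
      · exact .inl rfl
      · rw [List.forall_mem_cons] at hκ
        have hsum : 0 ≤ (κ.map d).sum :=
          List.sum_nonneg (List.forall_mem_map.2 fun k hk => (hκ.2 k hk).le)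
        simp only [List.map_cons, List.sum_cons]
        exact .inr (Set.mem_biUnion (x := d k) ⟨hκ.1, by lia⟩
          (Set.mem_image2_of_mem rfl ⟨hκ.2, (add_sub_cancel_left _ _).symm⟩))

section WordsOfShape

variable {K A : Type*}

/-- The word with underlying list of indices `κ` whose `i`-th letter has the parameter `x i`.  The
entries of `x` beyond the length of `κ` are ignored, so that words with different lists of indices
share one parameter space. -/
def wordOfShape (κ : List K) (x : ℕ → A) : List (K × A) := κ.zipIdx.map (Prod.map id x)

lemma map_fst_wordOfShape (κ : List K) (x : ℕ → A) : (wordOfShape κ x).map Prod.fst = κ := by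
  simp [wordOfShape, Function.comp_def]

lemma map_wordOfShape {B : Type*} (φ : A → B) (κ : List K) (x : ℕ → A) :
    (wordOfShape κ x).map (Prod.map id φ) = wordOfShape κ (φ ∘ x) := by
  simp [wordOfShape, Function.comp_def]

lemma exists_eq_of_mem_wordOfShape {κ : List K} {x : ℕ → A} {p : K × A}
    (hp : p ∈ wordOfShape κ x) : ∃ i, p.2 = x i := by
  obtain ⟨q, -, rfl⟩ := List.mem_map.1 hp
  exact ⟨q.2, rfl⟩

lemma exists_wordOfShape_eq [Inhabited A] (l : List (K × A)) :
    ∃ x : ℕ → A, wordOfShape (l.map Prod.fst) x = l :=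
  ⟨fun i => (l.map Prod.snd).getD i default, List.ext_getElem (by simp [wordOfShape])
    fun i _ hi => by simp [wordOfShape, hi]⟩

end WordsOfShape

section ExpPolynomialMaps

variable {𝕜 Z σ τ : Type*} [Field 𝕜] {E : Subalgebra 𝕜 (Z → 𝕜)}

/-- Composition with the map `A : Z → ℤ^σ` takes exp-polynomial functions to functions in the
algebra `E`. -/
def PullsBackExpPolynomials (E : Subalgebra 𝕜 (Z → 𝕜)) (A : Z → σ → ℤ) : Prop :=
  ∀ f ∈ expPolynomial 𝕜 σ, (fun z => f (A z)) ∈ E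

lemma pullsBackExpPolynomials_iff {A : Z → σ → ℤ} :
    PullsBackExpPolynomials E A ↔ ∀ j, (fun z => ((A z j : ℤ) : 𝕜)) ∈ E ∧
      ∀ a : 𝕜, a ≠ 0 → (fun z => a ^ A z j) ∈ E := by
  refine ⟨fun h j => ⟨h (fun m => ((m j : ℤ) : 𝕜)) (Algebra.subset_adjoin (.inl ⟨j, rfl⟩)),
    fun a ha => h (fun m => a ^ m j) (Algebra.subset_adjoin (.inr ⟨j, a, ha, rfl⟩))⟩,
    fun h f hf => ?_⟩
  induction hf using Algebra.adjoin_induction with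
  | mem f hf =>
    obtain ⟨j, rfl⟩ | ⟨j, a, ha, rfl⟩ := hf
    · exact (h j).1
    · exact (h j).2 a ha
  | algebraMap c => exact E.algebraMap_mem c
  | add f₁ f₂ _ _ h₁ h₂ => exact add_mem h₁ h₂
  | mul f₁ f₂ _ _ h₁ h₂ => exact mul_mem h₁ h₂

lemma PullsBackExpPolynomials.add {A B : Z → σ → ℤ} (hA : PullsBackExpPolynomials E A)
    (hB : PullsBackExpPolynomials E B) : PullsBackExpPolynomials E (A + B) := by
  rw [pullsBackExpPolynomials_iff] at hA hB ⊢
  refine fun j => ⟨?_, fun a ha => ?_⟩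
  · simp only [Pi.add_apply, Int.cast_add]
    exact add_mem (hA j).1 (hB j).1
  · simp only [Pi.add_apply, zpow_add₀ ha]
    exact mul_mem ((hA j).2 a ha) ((hB j).2 a ha)

lemma PullsBackExpPolynomials.sumElim {A : Z → σ → ℤ} {B : Z → τ → ℤ}
    (hA : PullsBackExpPolynomials E A) (hB : PullsBackExpPolynomials E B) :
    PullsBackExpPolynomials E fun z => Sum.elim (A z) (B z) := by
  rw [pullsBackExpPolynomials_iff] at hA hB ⊢
  rintro (j | j)
  · exact hA j
  · exact hB j

end ExpPolynomialMaps

section SeparableFunctions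

variable (𝕜 X Y : Type*) [Field 𝕜]

/-- The algebra of functions of the form `(x, y) ↦ ∑ᵢ aᵢ(x) bᵢ(y)` (finite sums), encoded by the
requirement that the functions `f(x, ·)` lie in a common finite-dimensional space. -/
def separableFunctions : Subalgebra 𝕜 (X × Y → 𝕜) where
  carrier := {f | ∃ Q : Submodule 𝕜 (Y → 𝕜), Q.FG ∧ ∀ x, (fun y => f (x, y)) ∈ Q}
  mul_mem' := fun ⟨Q, hQ, hf⟩ ⟨Q', hQ', hf'⟩ =>
    ⟨Q * Q', hQ.mul hQ', fun x => Submodule.mul_mem_mul (hf x) (hf' x)⟩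
  add_mem' := fun ⟨Q, hQ, hf⟩ ⟨Q', hQ', hf'⟩ =>
    ⟨Q ⊔ Q', hQ.sup hQ', fun x => Submodule.add_mem_sup (hf x) (hf' x)⟩
  algebraMap_mem' c := ⟨Submodule.span 𝕜 {fun _ => c}, Submodule.fg_span_singleton _,
    fun _ => Submodule.mem_span_singleton_self _⟩

variable {𝕜 X Y}

lemma fst_mem_separableFunctions (a : X → 𝕜) :
    (fun z => a z.1) ∈ separableFunctions 𝕜 X Y :=
  ⟨Submodule.span 𝕜 {1}, Submodule.fg_span_singleton _, fun x =>
    Submodule.mem_span_singleton.2 ⟨a x, funext fun y => by simp⟩⟩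

lemma snd_mem_separableFunctions (b : Y → 𝕜) :
    (fun z => b z.2) ∈ separableFunctions 𝕜 X Y :=
  ⟨Submodule.span 𝕜 {b}, Submodule.fg_span_singleton _,
    fun _ => Submodule.mem_span_singleton_self _⟩

lemma fg_map_span_range_of_separable {ι M P : Type*} [Fintype ι] [AddCommGroup M] [Module 𝕜 M]
    [AddCommGroup P] [Module 𝕜 P] (T : M →ₗ[𝕜] Y → P) (F : X → M) (w : ι → P)
    {q : ι → X × Y → 𝕜} (hq : ∀ s, q s ∈ separableFunctions 𝕜 X Y)
    (hF : ∀ x y, T (F x) y = ∑ s, q s (x, y) • w s) :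
    ((Submodule.span 𝕜 (Set.range F)).map T).FG := by
  choose Q hQ hqQ using hq
  have hfg : (⨆ s, (Q s).map (LinearMap.compLeft (LinearMap.toSpanSingleton 𝕜 P (w s)) Y)).FG :=
    Submodule.fg_iSup _ fun s => (hQ s).map _
  refine hfg.of_le ?_
  rw [Submodule.map_span_le]
  rintro _ ⟨x, rfl⟩
  have hTF : T (F x) = ∑ s, LinearMap.compLeft (LinearMap.toSpanSingleton 𝕜 P (w s)) Y
      fun y => q s (x, y) := by
    funext y
    simp [hF]
  rw [hTF]
  exact sum_mem fun s _ => Submodule.mem_iSup_of_mem s ⟨_, hqQ s x, rfl⟩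

lemma fg_of_fg_map_of_inf_iInf_ker_eq_bot {ι M : Type*} [Finite ι] [AddCommGroup M] [Module 𝕜 M]
    {P : ι → Type*} [∀ i, AddCommGroup (P i)] [∀ i, Module 𝕜 (P i)] (T : ∀ i, M →ₗ[𝕜] P i)
    {N : Submodule 𝕜 M} (hN : ∀ i, (N.map (T i)).FG)
    (hker : N ⊓ ⨅ i, LinearMap.ker (T i) = ⊥) : N.FG := by
  refine Submodule.fg_of_fg_map_of_fg_inf_ker (LinearMap.pi T) ?_ ?_
  · refine (Submodule.fg_pi hN).of_le ?_
    rintro _ ⟨m, hm, rfl⟩ i -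
    exact ⟨m, hm, rfl⟩
  · rw [LinearMap.ker_pi, hker]
    exact Submodule.fg_bot

end SeparableFunctions

section Modules

open UniversalEnvelopingAlgebra (ι)

attribute [local instance] LieRing.ofAssociativeRing

variable {𝕜 G : Type*} [Field 𝕜] [LieRing G] [LieAlgebra 𝕜 G]

section EnvelopingModules

variable {M : Type*} [AddCommGroup M] [Module (UniversalEnvelopingAlgebra 𝕜 G) M]

lemma adjoin_range_ι {R L : Type*} [CommRing R] [LieRing L] [LieAlgebra R L] :
    Algebra.adjoin R (Set.range (ι R : L →ₗ⁅R⁆ _)) = ⊤ := by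
  let E := Algebra.adjoin R (Set.range (ι R : L →ₗ⁅R⁆ _))
  let ιE : L →ₗ⁅R⁆ E :=
    { LinearMap.codRestrict (Subalgebra.toSubmodule E) (ι R).toLinearMap
        fun x => Algebra.subset_adjoin ⟨x, rfl⟩ with
      map_lie' := Subtype.ext (LieHom.map_lie ..) }
  have hid : E.val.comp (UniversalEnvelopingAlgebra.lift R ιE) = AlgHom.id R _ :=
    UniversalEnvelopingAlgebra.hom_ext R <| LieHom.ext fun x =>
      congrArg Subtype.val (UniversalEnvelopingAlgebra.lift_ι_apply R ιE x)
  refine eq_top_iff.2 fun u _ => ?_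
  have hu : E.val (UniversalEnvelopingAlgebra.lift R ιE u) = u := DFunLike.congr_fun hid u
  rw [← hu]
  exact Subtype.prop _

lemma ι_smul_ι_smul (x y : G) (m : M) :
    ι 𝕜 x • ι 𝕜 y • m = ι 𝕜 y • ι 𝕜 x • m + ι 𝕜 ⁅x, y⁆ • m := by
  rw [LieHom.map_lie, LieRing.of_associative_ring_bracket, sub_smul, mul_smul, mul_smul,
    add_sub_cancel]

variable [Module 𝕜 M] [IsScalarTower 𝕜 (UniversalEnvelopingAlgebra 𝕜 G) M]

lemma span_le_of_ι_smul_mem {S : Set M} {T : Submodule 𝕜 M} (hS : S ⊆ T)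
    (hT : ∀ x : G, ∀ m ∈ T, ι 𝕜 x • m ∈ T) :
    (Submodule.span (UniversalEnvelopingAlgebra 𝕜 G) S).restrictScalars 𝕜 ≤ T := by
  intro m hm
  induction hm using Submodule.span_induction with
  | mem m hm => exact hS hm
  | zero => exact zero_mem T
  | add a b _ _ ha hb => exact add_mem ha hb
  | smul u m hm' hm =>
    clear hm'
    have hu : u ∈ Algebra.adjoin 𝕜 (Set.range (ι 𝕜 : G →ₗ⁅𝕜⁆ _)) := by
      rw [adjoin_range_ι]
      exact Algebra.mem_top
    induction hu using Algebra.adjoin_induction generalizing m with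
    | mem u hu => obtain ⟨x, rfl⟩ := hu; exact hT x m hm
    | algebraMap c => rw [algebraMap_smul]; exact T.smul_mem c hm
    | add a b _ _ ha hb => rw [add_smul]; exact add_mem (ha m hm) (hb m hm)
    | mul a b _ _ ha hb => rw [mul_smul]; exact ha _ (hb m hm)

end EnvelopingModules

namespace LieGrading

variable (𝒵 : LieGrading 𝕜 G ℤ)

lemma prod_mem_envelopingComp {l : List (ℤ × G)} (hl : ∀ p ∈ l, p.2 ∈ 𝒵.comp p.1) :
    (l.map fun p => ι 𝕜 p.2).prod ∈ 𝒵.envelopingComp (l.map Prod.fst).sum :=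
  Submodule.subset_span ⟨l, hl, rfl, rfl⟩

lemma ι_mem_envelopingComp {i : ℤ} {x : G} (hx : x ∈ 𝒵.comp i) : ι 𝕜 x ∈ 𝒵.envelopingComp i := by
  simpa using 𝒵.prod_mem_envelopingComp (l := [(i, x)]) (by simpa using hx)

instance : SetLike.GradedMonoid 𝒵.envelopingComp where
  one_mem := 𝒵.prod_mem_envelopingComp (l := []) (by simp)
  mul_mem i j u u' hu hu' := by
    have h := Submodule.mul_mem_mul hu hu'
    rw [envelopingComp, envelopingComp, Submodule.span_mul_span] at h
    refine Submodule.span_le.2 ?_ h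
    rintro _ ⟨_, ⟨l, hl, rfl, rfl⟩, _, ⟨l', hl', rfl, rfl⟩, rfl⟩
    refine Submodule.subset_span ⟨l ++ l', fun p hp => ?_, by simp, by simp⟩
    exact (List.mem_append.1 hp).elim (hl p) (hl' p)

lemma homogeneous_induction {p : G → Prop} (mem : ∀ i, ∀ x ∈ 𝒵.comp i, p x) (zero : p 0)
    (add : ∀ x y, p x → p y → p (x + y)) (x : G) : p x :=
  Submodule.iSup_induction 𝒵.comp (motive := p)
    (𝒵.isInternal.submodule_iSup_eq_top ▸ Submodule.mem_top) mem zero add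

noncomputable instance : DirectSum.Decomposition 𝒵.comp := 𝒵.isInternal.chooseDecomposition

/-- The linear map `G → ⨁ U(G)_i` which sends `x ∈ G^(i)` to `ι x`, placed in degree `i`. -/
noncomputable def toEnvelopingSum : G →ₗ[𝕜] DirectSum ℤ fun i => 𝒵.envelopingComp i :=
  DirectSum.lmap (fun i =>
      LinearMap.codRestrict (𝒵.envelopingComp i) ((ι 𝕜).toLinearMap ∘ₗ (𝒵.comp i).subtype)
        fun x => 𝒵.ι_mem_envelopingComp x.2) ∘ₗ
    (DirectSum.decomposeLinearEquiv 𝒵.comp).toLinearMap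

lemma toEnvelopingSum_of_mem {i : ℤ} {x : G} (hx : x ∈ 𝒵.comp i) :
    𝒵.toEnvelopingSum x = DirectSum.of (fun i => 𝒵.envelopingComp i) i
      ⟨ι 𝕜 x, 𝒵.ι_mem_envelopingComp hx⟩ := by
  rw [toEnvelopingSum, LinearMap.comp_apply, LinearEquiv.coe_coe,
    DirectSum.decomposeLinearEquiv_apply, DirectSum.decompose_of_mem _ hx]
  exact DirectSum.lmap_of (M := fun i => 𝒵.comp i) _ i ⟨x, hx⟩

lemma toEnvelopingSum_lie (x y : G) : 𝒵.toEnvelopingSum ⁅x, y⁆ =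
    𝒵.toEnvelopingSum x * 𝒵.toEnvelopingSum y - 𝒵.toEnvelopingSum y * 𝒵.toEnvelopingSum x := by
  induction x using 𝒵.homogeneous_induction with
  | zero => simp
  | add a b ha hb => simp only [add_lie, map_add, ha, hb]; noncomm_ring
  | mem i x hx =>
    induction y using 𝒵.homogeneous_induction with
    | zero => simp
    | add a b ha hb => simp only [lie_add, map_add, ha, hb]; noncomm_ring
    | mem j y hy =>
      rw [𝒵.toEnvelopingSum_of_mem hx, 𝒵.toEnvelopingSum_of_mem hy,
        𝒵.toEnvelopingSum_of_mem (𝒵.lie_mem hx hy), eq_sub_iff_add_eq, DirectSum.of_mul_of,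
        DirectSum.of_mul_of, DirectSum.of_eq_of_gradedMonoid_eq (j := i + j)
          (b := ⟨_, add_comm j i ▸ SetLike.mul_mem_graded (𝒵.ι_mem_envelopingComp hy)
            (𝒵.ι_mem_envelopingComp hx)⟩) (Sigma.subtype_ext (add_comm j i) rfl), ← map_add]
      congr 1
      refine Subtype.ext ?_
      change ι 𝕜 ⁅x, y⁆ + ι 𝕜 y * ι 𝕜 x = ι 𝕜 x * ι 𝕜 y
      rw [LieHom.map_lie, LieRing.of_associative_ring_bracket, sub_add_cancel]

/-- The algebra homomorphism `U(G) → ⨁ U(G)_i` extending `toEnvelopingSum`. -/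
noncomputable def decomposeEnveloping :
    UniversalEnvelopingAlgebra 𝕜 G →ₐ[𝕜] DirectSum ℤ fun i => 𝒵.envelopingComp i :=
  UniversalEnvelopingAlgebra.lift 𝕜
    { 𝒵.toEnvelopingSum with map_lie' := 𝒵.toEnvelopingSum_lie _ _ }

lemma decomposeEnveloping_ι (x : G) : 𝒵.decomposeEnveloping (ι 𝕜 x) = 𝒵.toEnvelopingSum x :=
  UniversalEnvelopingAlgebra.lift_ι_apply ..

lemma decomposeEnveloping_prod {l : List (ℤ × G)} (hl : ∀ p ∈ l, p.2 ∈ 𝒵.comp p.1) :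
    𝒵.decomposeEnveloping (l.map fun p => ι 𝕜 p.2).prod =
      DirectSum.of (fun i => 𝒵.envelopingComp i) _ ⟨_, 𝒵.prod_mem_envelopingComp hl⟩ := by
  induction l with
  | nil => exact map_one _
  | cons p l ih =>
    rw [List.forall_mem_cons] at hl
    simp only [List.map_cons, List.prod_cons, map_mul, ih hl.2, decomposeEnveloping_ι,
      𝒵.toEnvelopingSum_of_mem hl.1]
    exact DirectSum.of_mul_of _ _

noncomputable instance : GradedAlgebra 𝒵.envelopingComp :=
  GradedAlgebra.ofAlgHom 𝒵.envelopingComp 𝒵.decomposeEnveloping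
    (UniversalEnvelopingAlgebra.hom_ext 𝕜 <| LieHom.ext fun x => by
      change DirectSum.coeAlgHom 𝒵.envelopingComp (𝒵.decomposeEnveloping (ι 𝕜 x)) = ι 𝕜 x
      rw [decomposeEnveloping_ι]
      induction x using 𝒵.homogeneous_induction with
      | zero => simp only [map_zero]
      | add x y hx hy => simp only [map_add, hx, hy]
      | mem i x hx => rw [𝒵.toEnvelopingSum_of_mem hx, DirectSum.coeAlgHom_of])
    fun i ⟨u, hu⟩ => by
      change 𝒵.decomposeEnveloping u = _
      induction hu using Submodule.span_induction with
      | mem u hu =>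
        obtain ⟨l, hl, rfl, rfl⟩ := hu
        exact 𝒵.decomposeEnveloping_prod hl
      | zero => rw [map_zero]; exact (map_zero _).symm
      | add u u' _ _ hu hu' => rw [map_add, hu, hu', ← map_add]; rfl
      | smul c u _ hu =>
        rw [map_smul, hu]
        exact (map_smul (DirectSum.lof 𝕜 ℤ (fun i => 𝒵.envelopingComp i) i) c _).symm

lemma isInternal_envelopingComp : DirectSum.IsInternal 𝒵.envelopingComp :=
  DirectSum.Decomposition.isInternal _

lemma iSup_envelopingComp : ⨆ i, 𝒵.envelopingComp i = ⊤ :=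
  𝒵.isInternal_envelopingComp.submodule_iSup_eq_top

variable {𝒵}

lemma mem_nonnegPart {i : ℤ} (hi : 0 ≤ i) {x : G} (hx : x ∈ 𝒵.comp i) : x ∈ 𝒵.nonnegPart :=
  Submodule.mem_iSup_of_mem (p := fun i : {i : ℤ // 0 ≤ i} => 𝒵.comp i) ⟨i, hi⟩ hx

lemma nonnegPart_induction {p : 𝒵.nonnegPart → Prop}
    (mem : ∀ i ≥ 0, ∀ x : 𝒵.nonnegPart, (x : G) ∈ 𝒵.comp i → p x) (zero : p 0)
    (add : ∀ x y, p x → p y → p (x + y)) (x : 𝒵.nonnegPart) : p x := by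
  obtain ⟨x, hx⟩ := x
  refine Submodule.iSup_induction' (fun i : {i : ℤ // 0 ≤ i} => 𝒵.comp i)
    (motive := fun x hx => p ⟨x, hx⟩) (fun i x hx => mem i i.2 _ hx) zero
    (fun x y hx hy => add ⟨x, hx⟩ ⟨y, hy⟩) hx

lemma commutator_mem_image_ι {i j : ℤ} {a b : UniversalEnvelopingAlgebra 𝕜 G}
    (ha : a ∈ ι 𝕜 '' (𝒵.comp i)) (hb : b ∈ ι 𝕜 '' (𝒵.comp j)) :
    a * b - b * a ∈ ι 𝕜 '' (𝒵.comp (i + j) : Set G) := by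
  obtain ⟨x, hx, rfl⟩ := ha
  obtain ⟨y, hy, rfl⟩ := hb
  exact ⟨⁅x, y⁆, 𝒵.lie_mem hx hy, LieHom.map_lie ..⟩

lemma envelopingComp_smul_mem {M : Type*} [AddCommGroup M] [Module 𝕜 M]
    [Module (UniversalEnvelopingAlgebra 𝕜 G) M]
    [IsScalarTower 𝕜 (UniversalEnvelopingAlgebra 𝕜 G) M] {W : Submodule 𝕜 M}
    (hzero : ∀ x ∈ 𝒵.comp 0, ∀ w ∈ W, ι 𝕜 x • w ∈ W)
    (hpos : ∀ i > 0, ∀ x ∈ 𝒵.comp i, ∀ w ∈ W, ι 𝕜 x • w = 0) {i : ℤ} (hi : 0 ≤ i)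
    {u : UniversalEnvelopingAlgebra 𝕜 G} (hu : u ∈ 𝒵.envelopingComp i) {w : M} (hw : w ∈ W) :
    u • w ∈ W := by
  induction hu using Submodule.span_induction with
  | mem u hu =>
    obtain ⟨l, hl, rfl, rfl⟩ := hu
    have h := prod_smul_mem_of_sum_nonneg (L := fun i => ι 𝕜 '' (𝒵.comp i)) (W := W.toAddSubgroup)
      commutator_mem_image_ι (by rintro _ ⟨x, hx, rfl⟩; exact hzero x hx)
      (by rintro i hi _ ⟨x, hx, rfl⟩; exact hpos i hi x hx)
      (l := l.map fun p => (p.1, ι 𝕜 p.2))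
      (List.forall_mem_map.2 fun p hp => ⟨p.2, hl p hp, rfl⟩)
      (by simpa [Function.comp_def] using hi) hw
    simpa [Function.comp_def] using h
  | zero => rw [zero_smul]; exact zero_mem W
  | add a b _ _ ha hb => rw [add_smul]; exact add_mem ha hb
  | smul c a _ ha => rw [smul_assoc]; exact W.smul_mem c ha

end LieGrading

section VermaModule

variable {𝒵 : LieGrading 𝕜 G ℤ} {V : Type*} [AddCommGroup V] [Module 𝕜 V]
  [LieRingModule 𝒵.zeroPart V] [LieModule 𝕜 𝒵.zeroPart V]

lemma inflatedRep_of_mem_zero {x : 𝒵.nonnegPart} (hx : (x : G) ∈ 𝒵.comp 0) (v : V) :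
    inflatedRep 𝒵 V x v = ⁅(⟨x, hx⟩ : 𝒵.zeroPart), v⁆ := by
  have : 𝒵.toZeroPart x = ⟨x, hx⟩ :=
    Subtype.ext (congrArg Subtype.val (𝒵.proj_of_mem hx))
  simp [inflatedRep, this]

lemma inflatedRep_of_mem_pos {i : ℤ} (hi : 0 < i) {x : 𝒵.nonnegPart} (hx : (x : G) ∈ 𝒵.comp i)
    (v : V) : inflatedRep 𝒵 V x v = 0 := by
  have : 𝒵.toZeroPart x = 0 :=
    Subtype.ext (congrArg Subtype.val (𝒵.proj_of_mem_ne hx hi.ne'))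
  simp [inflatedRep, this]

lemma ι_smul_toMTilde (x : 𝒵.nonnegPart) (v : V) :
    ι 𝕜 (x : G) • toMTilde 𝒵 V v = toMTilde 𝒵 V (inflatedRep 𝒵 V x v) := by
  refine (Submodule.Quotient.eq _).2 (Submodule.subset_span ⟨1, x, v, ?_⟩)
  simp [TensorProduct.smul_tmul']

variable (𝒵 V) in
lemma inducedRelations_le_iSup_inf :
    (inducedRelations 𝒵.nonnegPart (inflatedRep 𝒵 V)).restrictScalars 𝕜 ≤
      ⨆ i, (inducedRelations 𝒵.nonnegPart (inflatedRep 𝒵 V)).restrictScalars 𝕜 ⊓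
        tensorComp 𝒵.envelopingComp V i := by
  refine span_le_iSup_inf_of_subset 𝒵.iSup_envelopingComp ?_
  rintro _ ⟨u, x, v, rfl⟩
  rw [SetLike.mem_coe]
  induction x using 𝒵.nonnegPart_induction with
  | zero => simp
  | add x y hx hy =>
    simpa only [AddMemClass.coe_add, map_add, mul_add, LinearMap.add_apply,
      TensorProduct.add_tmul, TensorProduct.tmul_add, add_sub_add_comm] using add_mem hx hy
  | mem j hj x hx =>
    have hu : u ∈ ⨆ i, 𝒵.envelopingComp i := 𝒵.iSup_envelopingComp ▸ Submodule.mem_top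
    induction hu using Submodule.iSup_induction' with
    | zero => simp
    | add a b _ _ ha hb =>
      simpa only [add_mul, TensorProduct.add_tmul, add_sub_add_comm] using add_mem ha hb
    | mem i u hu =>
      refine Submodule.mem_iSup_of_mem (i + j)
        ⟨Submodule.subset_span ⟨u, x, v, rfl⟩, sub_mem ?_ ?_⟩
      · exact tmul_mem_tensorComp (SetLike.mul_mem_graded hu (𝒵.ι_mem_envelopingComp hx)) v
      · obtain rfl | hj := hj.eq_or_lt
        · rw [add_zero]
          exact tmul_mem_tensorComp hu _
        · rw [inflatedRep_of_mem_pos hj hx, TensorProduct.tmul_zero]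
          exact zero_mem _

variable (𝒵 V)

lemma mkQ_tmul (u : UniversalEnvelopingAlgebra 𝕜 G) (v : V) :
    (inducedRelations 𝒵.nonnegPart (inflatedRep 𝒵 V)).mkQ (u ⊗ₜ v) = u • toMTilde 𝒵 V v := by
  rw [toMTilde, LinearMap.comp_apply, LinearMap.restrictScalars_apply, ← map_smul,
    TensorProduct.mk_apply, TensorProduct.smul_tmul', smul_eq_mul, mul_one]

lemma map_tensorComp_mkQ (i : ℤ) :
    (tensorComp 𝒵.envelopingComp V i).map
      ((inducedRelations 𝒵.nonnegPart (inflatedRep 𝒵 V)).mkQ.restrictScalars 𝕜) =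
        MTildeComp 𝒵 V i := by
  refine le_antisymm (Submodule.map_le_iff_le_comap.2 (Submodule.map₂_le.2 fun u hu v _ =>
    Submodule.subset_span ⟨u, hu, v, mkQ_tmul 𝒵 V u v⟩)) (Submodule.span_le.2 ?_)
  rintro _ ⟨u, hu, v, rfl⟩
  exact ⟨u ⊗ₜ v, tmul_mem_tensorComp hu v, mkQ_tmul 𝒵 V u v⟩

lemma isInternal_MTildeComp : DirectSum.IsInternal (MTildeComp 𝒵 V) := by
  simp only [funext fun i => (map_tensorComp_mkQ 𝒵 V i).symm]
  exact isInternal_map_mkQ (isInternal_tensorComp 𝒵.isInternal_envelopingComp)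
    (inducedRelations_le_iSup_inf 𝒵 V)

instance : SetLike.GradedSMul 𝒵.envelopingComp (MTildeComp 𝒵 V) where
  smul_mem {i j u} m hu hm := by
    rw [← map_tensorComp_mkQ] at hm
    obtain ⟨z, hz, rfl⟩ := hm
    rw [LinearMap.restrictScalars_apply, ← map_smul, ← map_tensorComp_mkQ]
    exact ⟨u • z, SetLike.GradedSMul.smul_mem hu hz, rfl⟩

instance : SetLike.GradedSMul 𝒵.envelopingComp (MQuotComp 𝒵 V) where
  smul_mem {i j u} m hu hm := by
    obtain ⟨z, hz, rfl⟩ := hm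
    rw [LinearMap.restrictScalars_apply, ← map_smul]
    exact ⟨u • z, SetLike.GradedSMul.smul_mem hu hz, rfl⟩

lemma span_range_toMTilde :
    Submodule.span (UniversalEnvelopingAlgebra 𝕜 G) (Set.range (toMTilde 𝒵 V)) = ⊤ := by
  refine eq_top_iff.2 fun m _ => ?_
  obtain ⟨z, rfl⟩ := Submodule.mkQ_surjective _ m
  induction z using TensorProduct.induction_on with
  | zero => simp
  | add a b ha hb => rw [map_add]; exact add_mem (ha trivial) (hb trivial)
  | tmul u v =>
    rw [mkQ_tmul]
    exact Submodule.smul_mem _ u (Submodule.subset_span ⟨v, rfl⟩)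

variable {𝒵 V}

lemma ι_smul_toMTilde_mem {i : ℤ} (hi : 0 ≤ i) {x : G} (hx : x ∈ 𝒵.comp i) (v : V) :
    ι 𝕜 x • toMTilde 𝒵 V v ∈ LinearMap.range (toMTilde 𝒵 V) :=
  ⟨_, (ι_smul_toMTilde ⟨x, 𝒵.mem_nonnegPart hi hx⟩ v).symm⟩

lemma ι_smul_toMTilde_eq_zero {i : ℤ} (hi : 0 < i) {x : G} (hx : x ∈ 𝒵.comp i) (v : V) :
    ι 𝕜 x • toMTilde 𝒵 V v = 0 := by
  rw [ι_smul_toMTilde ⟨x, 𝒵.mem_nonnegPart hi.le hx⟩, inflatedRep_of_mem_pos hi hx, map_zero]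

lemma MTildeComp_le_range {i : ℤ} (hi : 0 ≤ i) :
    MTildeComp 𝒵 V i ≤ LinearMap.range (toMTilde 𝒵 V) := by
  refine Submodule.span_le.2 ?_
  rintro _ ⟨u, hu, v, rfl⟩
  refine LieGrading.envelopingComp_smul_mem ?_ ?_ hi hu ⟨v, rfl⟩
  · rintro x hx _ ⟨w, rfl⟩
    exact ι_smul_toMTilde_mem le_rfl hx w
  · rintro i hi x hx _ ⟨w, rfl⟩
    exact ι_smul_toMTilde_eq_zero hi hx w

lemma toMTilde_mem (v : V) : toMTilde 𝒵 V v ∈ MTildeComp 𝒵 V 0 :=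
  Submodule.subset_span ⟨1, SetLike.one_mem_graded 𝒵.envelopingComp, v, (one_smul _ _).symm⟩

variable (𝒵 V) in
lemma MTildeComp_zero : MTildeComp 𝒵 V 0 = LinearMap.range (toMTilde 𝒵 V) :=
  le_antisymm (MTildeComp_le_range le_rfl) (LinearMap.range_le_iff_comap.2
    (eq_top_iff.2 fun v _ => toMTilde_mem v))

lemma MTildeComp_of_pos {i : ℤ} (hi : 0 < i) : MTildeComp 𝒵 V i = ⊥ :=
  Disjoint.eq_bot_of_le
    ((isInternal_MTildeComp 𝒵 V).submodule_iSupIndep.pairwiseDisjoint hi.ne')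
    ((MTildeComp_le_range hi.le).trans (MTildeComp_zero 𝒵 V).ge)

lemma IsGradedSubmodule.inf_range_eq_bot_iff
    {N : Submodule (UniversalEnvelopingAlgebra 𝕜 G) (MTilde 𝒵 V)} (hN : IsGradedSubmodule 𝒵 V N) :
    N.restrictScalars 𝕜 ⊓ LinearMap.range (toMTilde 𝒵 V) = ⊥ ↔
      N.restrictScalars 𝕜 ≤ ⨆ (i) (_ : i ≠ 0), MTildeComp 𝒵 V i := by
  rw [← MTildeComp_zero]
  refine ⟨fun h => hN.le.trans (iSup_le fun i => ?_), fun h => ?_⟩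
  · obtain rfl | hi := eq_or_ne i 0
    · exact h.le.trans bot_le
    · exact inf_le_right.trans (le_iSup₂_of_le i hi le_rfl)
  · exact (((isInternal_MTildeComp 𝒵 V).submodule_iSupIndep 0).mono_right h).symm.eq_bot

variable (𝒵 V) in
lemma MTildeRad_le_iSup_ne_zero :
    (MTildeRad 𝒵 V).restrictScalars 𝕜 ≤ ⨆ (i) (_ : i ≠ 0), MTildeComp 𝒵 V i := by
  intro m hm
  rw [Submodule.restrictScalars_mem, MTildeRad, sSup_eq_iSup'] at hm
  induction hm using Submodule.iSup_induction' with
  | zero => exact zero_mem _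
  | add x y _ _ hx hy => exact add_mem hx hy
  | mem N m hm => exact N.2.1.inf_range_eq_bot_iff.1 N.2.2 hm

variable (𝒵 V) in
lemma isGradedSubmodule_MTildeRad : IsGradedSubmodule 𝒵 V (MTildeRad 𝒵 V) := by
  refine le_antisymm (fun m hm => ?_) (iSup_le fun i => inf_le_left)
  rw [Submodule.restrictScalars_mem, MTildeRad, sSup_eq_iSup'] at hm
  induction hm using Submodule.iSup_induction' with
  | zero => exact zero_mem _
  | add x y _ _ hx hy => exact add_mem hx hy
  | mem N m hm =>
    have hle : N.1.restrictScalars 𝕜 ≤ (MTildeRad 𝒵 V).restrictScalars 𝕜 := le_sSup N.2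
    exact iSup_mono (fun i => inf_le_inf_right _ hle) (N.2.1.le hm)

lemma IsGradedSubmodule.le_MTildeRad
    {N : Submodule (UniversalEnvelopingAlgebra 𝕜 G) (MTilde 𝒵 V)} (hN : IsGradedSubmodule 𝒵 V N)
    (h : N.restrictScalars 𝕜 ≤ ⨆ (i) (_ : i ≠ 0), MTildeComp 𝒵 V i) : N ≤ MTildeRad 𝒵 V :=
  le_sSup ⟨hN, hN.inf_range_eq_bot_iff.2 h⟩

variable (𝒵 V) in
lemma isModuleGrading_MQuotComp : IsModuleGrading 𝒵 (MQuotComp 𝒵 V) where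
  isInternal :=
    isInternal_map_mkQ (isInternal_MTildeComp 𝒵 V) (isGradedSubmodule_MTildeRad 𝒵 V).le
  smul_mem hx hm := SetLike.GradedSMul.smul_mem (𝒵.ι_mem_envelopingComp hx) hm

lemma MQuotComp_of_pos {i : ℤ} (hi : 0 < i) : MQuotComp 𝒵 V i = ⊥ := by
  rw [MQuotComp, MTildeComp_of_pos hi, Submodule.map_bot]

lemma ι_smul_mem_MQuotComp_zero {i : ℤ} (hi : 0 ≤ i) {x : G} (hx : x ∈ 𝒵.comp i) {w : MQuot 𝒵 V}
    (hw : w ∈ MQuotComp 𝒵 V 0) : ι 𝕜 x • w ∈ MQuotComp 𝒵 V 0 := by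
  have h := (isModuleGrading_MQuotComp 𝒵 V).smul_mem hx hw
  rw [add_zero] at h
  obtain rfl | hi := hi.eq_or_lt
  · exact h
  · rw [MQuotComp_of_pos hi, Submodule.mem_bot] at h
    exact h ▸ zero_mem _

variable (𝒵 V) in
lemma span_MQuotComp_zero :
    Submodule.span (UniversalEnvelopingAlgebra 𝕜 G) (MQuotComp 𝒵 V 0 : Set (MQuot 𝒵 V)) = ⊤ := by
  have h := Submodule.map_span (MTildeRad 𝒵 V).mkQ (Set.range (toMTilde 𝒵 V))
  rw [span_range_toMTilde, Submodule.map_top, Submodule.range_mkQ] at h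
  rw [MQuotComp, MTildeComp_zero]
  exact h.symm

lemma eq_zero_of_forall_envelopingComp_smul {i : ℤ} {m : MQuot 𝒵 V} (hm : m ∈ MQuotComp 𝒵 V i)
    (h : ∀ u ∈ 𝒵.envelopingComp (-i), u • m = 0) : m = 0 := by
  obtain ⟨m, hm, rfl⟩ := hm
  have hN : IsGradedSubmodule 𝒵 V (Submodule.span _ {m}) :=
    le_antisymm (span_le_iSup_inf_of_subset 𝒵.iSup_envelopingComp (Set.singleton_subset_iff.2
      (Submodule.mem_iSup_of_mem i ⟨Submodule.mem_span_singleton_self m, hm⟩)))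
      (iSup_le fun i => inf_le_left)
  refine (Submodule.Quotient.mk_eq_zero _).2
    (hN.le_MTildeRad (fun y hy => ?_) (Submodule.mem_span_singleton_self m))
  obtain ⟨u, rfl⟩ := Submodule.mem_span_singleton.1 hy
  have hu : u ∈ ⨆ j, 𝒵.envelopingComp j := 𝒵.iSup_envelopingComp ▸ Submodule.mem_top
  clear hy
  induction hu using Submodule.iSup_induction' with
  | zero => rw [zero_smul]; exact zero_mem _
  | add a b _ _ ha hb => rw [add_smul]; exact add_mem ha hb
  | mem j u hu =>
    obtain hji | hji := eq_or_ne (j + i) 0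
    · refine MTildeRad_le_iSup_ne_zero 𝒵 V ((Submodule.Quotient.mk_eq_zero _).1 ?_)
      exact h u (eq_neg_of_add_eq_zero_left hji ▸ hu)
    · exact le_iSup₂_of_le (f := fun i (_ : i ≠ 0) => MTildeComp 𝒵 V i) _ hji le_rfl
        (SetLike.GradedSMul.smul_mem hu hm)

/-- The vectors of degree `j` in `M(V)` which are annihilated by `G^+`. -/
def singularVectors (𝒵 : LieGrading 𝕜 G ℤ) (V : Type*) [AddCommGroup V] [Module 𝕜 V]
    [LieRingModule 𝒵.zeroPart V] [LieModule 𝕜 𝒵.zeroPart V] (j : ℤ) :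
    Submodule 𝕜 (MQuot 𝒵 V) where
  carrier := {m | m ∈ MQuotComp 𝒵 V j ∧ ∀ i > 0, ∀ x ∈ 𝒵.comp i, ι 𝕜 x • m = 0}
  zero_mem' := ⟨zero_mem _, fun _ _ _ _ => smul_zero _⟩
  add_mem' ha hb := ⟨add_mem ha.1 hb.1, fun i hi x hx => by
    rw [smul_add, ha.2 i hi x hx, hb.2 i hi x hx, add_zero]⟩
  smul_mem' c m hm := ⟨Submodule.smul_mem _ c hm.1, fun i hi x hx => by
    rw [smul_comm, hm.2 i hi x hx, smul_zero]⟩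

lemma singularVectors_eq_bot {j : ℤ} (hj : j < 0) : singularVectors 𝒵 V j = ⊥ := by
  refine eq_bot_iff.2 fun m hm => eq_zero_of_forall_envelopingComp_smul hm.1 fun u hu => ?_
  have hmem : u • m ∈ singularVectors 𝒵 V j := by
    refine LieGrading.envelopingComp_smul_mem (W := singularVectors 𝒵 V j)
      (fun x hx w hw => ⟨?_, fun i hi y hy => ?_⟩)
      (fun i hi x hx w hw => hw.2 i hi x hx) (by lia) hu hm
    · simpa using (isModuleGrading_MQuotComp 𝒵 V).smul_mem hx hw.1
    · rw [ι_smul_ι_smul, hw.2 i hi y hy, smul_zero, zero_add]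
      exact hw.2 (i + 0) (by lia) _ (𝒵.lie_mem hy hx)
  have hdeg : u • m ∈ MQuotComp 𝒵 V (-j + j) := SetLike.GradedSMul.smul_mem hu hm.1
  rw [neg_add_cancel] at hdeg
  have hindep := (isModuleGrading_MQuotComp 𝒵 V).isInternal.submodule_iSupIndep
  exact Submodule.disjoint_def.1 (hindep.pairwiseDisjoint hj.ne) _ hmem.1 hdeg

end VermaModule

section SpanningFamily

variable {K : Type*} {n : ℕ} {𝒢 : LieGrading 𝕜 G (Fin n → ℤ)} {𝒵 : LieGrading 𝕜 G ℤ}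
  {deg : K → ℤ} {g : K → (Fin n → ℤ) → G}

/-- The product in `U(G)` of the elements `g_k(α)` for the letters `(k, α)` of the word `l`. -/
def wordProd (𝕜 : Type*) {G : Type*} [Field 𝕜] [LieRing G] [LieAlgebra 𝕜 G] {K A : Type*}
    (g : K → A → G) (l : List (K × A)) : UniversalEnvelopingAlgebra 𝕜 G :=
  (l.map fun p => ι 𝕜 (g p.1 p.2)).prod

lemma wordProd_cons {A : Type*} (g : K → A → G) (p : K × A) (l : List (K × A)) :
    wordProd 𝕜 g (p :: l) = ι 𝕜 (g p.1 p.2) * wordProd 𝕜 g l := by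
  rw [wordProd, List.map_cons, List.prod_cons, wordProd]

lemma wordProd_append {A : Type*} (g : K → A → G) (l l' : List (K × A)) :
    wordProd 𝕜 g (l ++ l') = wordProd 𝕜 g l * wordProd 𝕜 g l' := by
  rw [wordProd, List.map_append, List.prod_append, wordProd, wordProd]

lemma IsExtragraded.comp_le (hG : IsExtragraded 𝒢 𝒵 deg g) {i : ℤ}
    {N : Submodule 𝕜 G} (hN : ∀ k α, deg k = i → g k α ∈ N) : 𝒵.comp i ≤ N := by
  rw [← hG.span_deg i, Submodule.span_le]
  rintro _ ⟨k, α, hk, rfl⟩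
  exact hN k α hk

lemma IsExtragraded.exists_bracket_homogeneous (hG : IsExtragraded 𝒢 𝒵 deg g) :
    ∃ f : K → K → K →₀ expPolynomial 𝕜 (Fin n ⊕ Fin n),
      (∀ k r, ∀ s ∈ (f k r).support, deg s = deg k + deg r) ∧ ∀ k r α β, ⁅g k α, g r β⁆ =
        (f k r).sum fun s h => (h : (Fin n ⊕ Fin n → ℤ) → 𝕜) (Sum.elim α β) • g s (α + β) := by
  obtain ⟨f, hf⟩ := hG.bracket
  refine ⟨fun k r => (f k r).filter fun s => deg s = deg k + deg r,
    fun k r s hs => ?_, fun k r α β => ?_⟩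
  · rw [Finsupp.support_filter, Finset.mem_filter] at hs
    exact hs.2
  · have hproj := congrArg (fun x => (𝒵.proj (deg k + deg r) x : G)) (hf k r α β)
    simp only [𝒵.proj_of_mem (𝒵.lie_mem (hG.mem_deg k α) (hG.mem_deg r β))] at hproj
    rw [hproj, Finsupp.sum, map_sum, Submodule.coe_sum, Finsupp.sum, Finsupp.support_filter,
      Finset.sum_filter]
    refine Finset.sum_congr rfl fun s _ => ?_
    split_ifs with hs
    · rw [map_smul, Submodule.coe_smul, 𝒵.proj_of_mem (hs ▸ hG.mem_deg s _),
        Finsupp.filter_apply_pos (fun s => deg s = deg k + deg r) _ hs]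
    · rw [map_smul, 𝒵.proj_of_mem_ne (hG.mem_deg s _) hs, smul_zero, Submodule.coe_zero]

lemma IsExtragraded.wordProd_mem_envelopingComp (hG : IsExtragraded 𝒢 𝒵 deg g)
    (l : List (K × (Fin n → ℤ))) :
    wordProd 𝕜 g l ∈ 𝒵.envelopingComp (l.map fun p => deg p.1).sum :=
  Submodule.subset_span ⟨l.map fun p => (deg p.1, g p.1 p.2),
    List.forall_mem_map.2 fun p _ => hG.mem_deg p.1 p.2, by simp [Function.comp_def],
    by rw [wordProd, List.map_map]; rfl⟩

section NegativeWords

variable {M : Type*} [AddCommGroup M] [Module 𝕜 M] [Module (UniversalEnvelopingAlgebra 𝕜 G) M]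

/-- The span of the vectors `l • w`, where `w ∈ W` and `l` is a word of total degree `i` all of
whose letters have negative degree. -/
def negWordSpan {A : Type*} (deg : K → ℤ) (g : K → A → G) (W : Submodule 𝕜 M) (i : ℤ) :
    Submodule 𝕜 M :=
  Submodule.span 𝕜 {m | ∃ l : List (K × A), (∀ p ∈ l, deg p.1 < 0) ∧
    (l.map fun p => deg p.1).sum = i ∧ ∃ w ∈ W, m = wordProd 𝕜 g l • w}

lemma wordProd_smul_mem_negWordSpan {A : Type*} {g : K → A → G} {W : Submodule 𝕜 M}
    {l : List (K × A)} (hl : ∀ p ∈ l, deg p.1 < 0) {w : M} (hw : w ∈ W) :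
    wordProd 𝕜 g l • w ∈ ⨆ i, negWordSpan deg g W i :=
  Submodule.mem_iSup_of_mem _ (Submodule.subset_span ⟨l, hl, rfl, w, hw, rfl⟩)

lemma iSup_negWordSpan_le {A : Type*} {g : K → A → G} {W N : Submodule 𝕜 M}
    (h : ∀ l : List (K × A), (∀ p ∈ l, deg p.1 < 0) → ∀ w ∈ W, wordProd 𝕜 g l • w ∈ N) :
    ⨆ i, negWordSpan deg g W i ≤ N := by
  refine iSup_le fun i => Submodule.span_le.2 ?_
  rintro _ ⟨l, hl, -, w, hw, rfl⟩
  exact h l hl w hw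

variable [IsScalarTower 𝕜 (UniversalEnvelopingAlgebra 𝕜 G) M]

lemma ι_smul_mem_iSup_negWordSpan {A : Type*} {g : K → A → G} {W : Submodule 𝕜 M} {k : K}
    (hk : deg k < 0) (α : A) {m : M} (hm : m ∈ ⨆ i, negWordSpan deg g W i) :
    ι 𝕜 (g k α) • m ∈ ⨆ i, negWordSpan deg g W i := by
  refine iSup_negWordSpan_le (N := Submodule.comap (Algebra.lsmul 𝕜 𝕜 M (ι 𝕜 (g k α)))
    (⨆ i, negWordSpan deg g W i)) (fun l hl w hw => ?_) hm
  have h := wordProd_smul_mem_negWordSpan (g := g) (List.forall_mem_cons.2 ⟨hk, hl⟩) hw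
    (l := (k, α) :: l)
  rwa [wordProd_cons, mul_smul] at h

lemma IsExpPolynomialLie.ι_smul_mem (hG : IsExpPolynomialLie 𝒢 g) {T : Submodule 𝕜 M} {m : M}
    (h : ∀ k α, ι 𝕜 (g k α) • m ∈ T) (x : G) : ι 𝕜 x • m ∈ T := by
  have hx : x ∈ Submodule.span 𝕜 {x | ∃ k α, x = g k α} := hG.span_eq_top ▸ Submodule.mem_top
  induction hx using Submodule.span_induction with
  | mem x hx => obtain ⟨k, α, rfl⟩ := hx; exact h k α
  | zero => rw [map_zero, zero_smul]; exact zero_mem T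
  | add x y _ _ hx hy => rw [map_add, add_smul]; exact add_mem hx hy
  | smul c x _ hx => rw [map_smul, smul_assoc]; exact T.smul_mem c hx

lemma IsExtragraded.ι_smul_wordProd_smul_mem (hG : IsExtragraded 𝒢 𝒵 deg g) {W : Submodule 𝕜 M}
    (hW : ∀ i ≥ 0, ∀ x ∈ 𝒵.comp i, ∀ w ∈ W, ι 𝕜 x • w ∈ W)
    (x : G) {l : List (K × (Fin n → ℤ))} (hl : ∀ p ∈ l, deg p.1 < 0) {w : M} (hw : w ∈ W) :
    ι 𝕜 x • wordProd 𝕜 g l • w ∈ ⨆ i, negWordSpan deg g W i := by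
  induction l generalizing x with
  | nil =>
    refine hG.ι_smul_mem (fun k α => ?_) x
    obtain hk | hk := lt_or_ge (deg k) 0
    · exact ι_smul_mem_iSup_negWordSpan hk α (wordProd_smul_mem_negWordSpan hl hw)
    · rw [wordProd, List.map_nil, List.prod_nil, one_smul]
      simpa [wordProd] using wordProd_smul_mem_negWordSpan (𝕜 := 𝕜) (g := g) hl
        (hW _ hk _ (hG.mem_deg k α) w hw)
  | cons p l ih =>
    refine hG.ι_smul_mem (fun k α => ?_) x
    obtain hk | - := lt_or_ge (deg k) 0
    · exact ι_smul_mem_iSup_negWordSpan hk α (wordProd_smul_mem_negWordSpan hl hw)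
    · obtain ⟨hp, hl⟩ := List.forall_mem_cons.1 hl
      rw [wordProd_cons, mul_smul, ι_smul_ι_smul]
      exact add_mem (ι_smul_mem_iSup_negWordSpan hp _ (ih _ hl)) (ih _ hl)

lemma IsExtragraded.iSup_negWordSpan (hG : IsExtragraded 𝒢 𝒵 deg g) {W : Submodule 𝕜 M}
    (hW : ∀ i ≥ 0, ∀ x ∈ 𝒵.comp i, ∀ w ∈ W, ι 𝕜 x • w ∈ W)
    (htop : Submodule.span (UniversalEnvelopingAlgebra 𝕜 G) (W : Set M) = ⊤) :
    ⨆ i, negWordSpan deg g W i = ⊤ := by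
  have h : (Submodule.span (UniversalEnvelopingAlgebra 𝕜 G) (W : Set M)).restrictScalars 𝕜 ≤
      ⨆ i, negWordSpan deg g W i := by
    refine span_le_of_ι_smul_mem (fun w hw => ?_) fun x m hm => ?_
    · have h := wordProd_smul_mem_negWordSpan (𝕜 := 𝕜) (g := g) (deg := deg) (l := []) (by simp) hw
      rwa [wordProd, List.map_nil, List.prod_nil, one_smul] at h
    · exact iSup_negWordSpan_le
        (N := Submodule.comap (Algebra.lsmul 𝕜 𝕜 M (ι 𝕜 x)) (⨆ i, negWordSpan deg g W i))
        (fun l hl w hw => hG.ι_smul_wordProd_smul_mem hW x hl hw) hm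
  rwa [htop, Submodule.restrictScalars_top, top_le_iff] at h

lemma negWordSpan_span_le {A : Type*} [Inhabited A] {g : K → A → G} {J : Type*}
    (w : J → M) (i : ℤ) :
    negWordSpan deg g (Submodule.span 𝕜 (Set.range w)) i ≤
      ⨆ κ : {κ : List K | (∀ k ∈ κ, deg k < 0) ∧ (κ.map deg).sum = i}, ⨆ j,
        Submodule.span 𝕜 (Set.range fun x : ℕ → A => wordProd 𝕜 g (wordOfShape κ.1 x) • w j) := by
  refine Submodule.span_le.2 ?_
  rintro _ ⟨l, hl, hsum, v, hv, rfl⟩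
  obtain ⟨x, hx⟩ := exists_wordOfShape_eq l
  refine Submodule.mem_iSup_of_mem
    ⟨l.map Prod.fst, List.forall_mem_map.2 hl, by rw [List.map_map]; exact hsum⟩ ?_
  induction hv using Submodule.span_induction with
  | mem v hv =>
    obtain ⟨j, rfl⟩ := hv
    exact Submodule.mem_iSup_of_mem j (Submodule.subset_span ⟨x, by simp only [hx]⟩)
  | zero => rw [smul_zero]; exact zero_mem _
  | add a b _ _ ha hb => rw [smul_add]; exact add_mem ha hb
  | smul c a _ ha => rw [smul_comm]; exact Submodule.smul_mem _ c ha

end NegativeWords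

section MatrixCoefficients

variable {Z : Type*} {E : Subalgebra 𝕜 (Z → 𝕜)} {M : Type*} [AddCommGroup M] [Module 𝕜 M]
  [Module (UniversalEnvelopingAlgebra 𝕜 G) M] [IsScalarTower 𝕜 (UniversalEnvelopingAlgebra 𝕜 G) M]

variable (E) in
/-- The `E`-linear span, inside the algebra of functions `Z → U(G)`, of the families
`z ↦ g_k(A(z))`, where `k` has degree `i` and `A` pulls exp-polynomial functions back into `E`. -/
def familySpan (deg : K → ℤ) (g : K → (Fin n → ℤ) → G) (i : ℤ) :
    Submodule E (Z → UniversalEnvelopingAlgebra 𝕜 G) :=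
  Submodule.span E {F | ∃ (k : K) (A : Z → Fin n → ℤ), deg k = i ∧ PullsBackExpPolynomials E A ∧
    F = fun z => ι 𝕜 (g k (A z))}

lemma IsExtragraded.commutator_mem_familySpan (hG : IsExtragraded 𝒢 𝒵 deg g) {i j : ℤ}
    {a b : Z → UniversalEnvelopingAlgebra 𝕜 G} (ha : a ∈ familySpan E deg g i)
    (hb : b ∈ familySpan E deg g j) : a * b - b * a ∈ familySpan E deg g (i + j) := by
  induction ha, hb using Submodule.span_induction₂ with
  | mem_mem a b ha hb =>
    obtain ⟨k, A, rfl, hA, rfl⟩ := ha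
    obtain ⟨r, B, rfl, hB, rfl⟩ := hb
    obtain ⟨f, hfdeg, hf⟩ := hG.exists_bracket_homogeneous
    have hsum : (fun z => ι 𝕜 (g k (A z))) * (fun z => ι 𝕜 (g r (B z))) -
        (fun z => ι 𝕜 (g r (B z))) * (fun z => ι 𝕜 (g k (A z))) =
        ∑ s ∈ (f k r).support, (⟨_, hA.sumElim hB _ (f k r s).2⟩ : E) •
          fun z => ι 𝕜 (g s ((A + B) z)) := by
      funext z
      rw [Pi.sub_apply, Pi.mul_apply, Pi.mul_apply, ← LieRing.of_associative_ring_bracket,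
        ← LieHom.map_lie, hf, Finsupp.sum, map_sum, Finset.sum_apply]
      exact Finset.sum_congr rfl fun s _ => map_smul _ _ _
    rw [hsum]
    exact sum_mem fun s hs => Submodule.smul_mem _ _
      (Submodule.subset_span ⟨s, A + B, hfdeg k r s hs, hA.add hB, rfl⟩)
  | zero_left b _ => rw [zero_mul, mul_zero, sub_zero]; exact zero_mem _
  | zero_right a _ => rw [zero_mul, mul_zero, sub_zero]; exact zero_mem _
  | add_left a a' b _ _ _ h h' =>
    rw [add_mul, mul_add, add_sub_add_comm]; exact add_mem h h'
  | add_right a b b' _ _ _ h h' =>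
    rw [add_mul, mul_add, add_sub_add_comm]; exact add_mem h h'
  | smul_left c a b _ _ h =>
    rw [smul_mul_assoc, mul_smul_comm, ← smul_sub]; exact Submodule.smul_mem _ c h
  | smul_right c a b _ _ h =>
    rw [smul_mul_assoc, mul_smul_comm, ← smul_sub]; exact Submodule.smul_mem _ c h

lemma smul_mem_of_mem_familySpan {J : Type*} {w : J → M} {i : ℤ} {N : Submodule E (Z → M)}
    (hN : ∀ k, deg k = i → ∀ A, PullsBackExpPolynomials E A → ∀ j,
      (fun z => ι 𝕜 (g k (A z)) • w j) ∈ N)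
    {a : Z → UniversalEnvelopingAlgebra 𝕜 G} (ha : a ∈ familySpan E deg g i) {m : Z → M}
    (hm : m ∈ Submodule.span E (Set.range fun j => Function.const Z (w j))) : a • m ∈ N := by
  refine LinearMap.BilinMap.apply_apply_mem_of_mem_span N _ _
    (Algebra.lsmul E E (Z → M)).toLinearMap ?_ a m ha hm
  rintro _ ⟨k, A, hk, hA, rfl⟩ _ ⟨j, rfl⟩
  exact hN k hk A hA j

/-- The vectors `w_j` are annihilated by `G^+`, and `G^(0)` acts on them with exp-polynomial
coefficients, as on the basis of an exp-polynomial `G^(0)`-module.  They may be linearly dependent,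
as may the images in `M(V)` of a basis of `V`. -/
structure IsExpPolynomialFamily (𝕜 : Type*) {G K M J : Type*} [Field 𝕜] [LieRing G]
    [LieAlgebra 𝕜 G] [AddCommGroup M] [Module 𝕜 M] [Module (UniversalEnvelopingAlgebra 𝕜 G) M]
    [Fintype J] {n : ℕ} (deg : K → ℤ) (g : K → (Fin n → ℤ) → G) (w : J → M) : Prop where
  smul_of_zero : ∀ k, deg k = 0 → ∀ j, ∃ h : J → expPolynomial 𝕜 (Fin n), ∀ α,
    ι 𝕜 (g k α) • w j = ∑ s, (h s : (Fin n → ℤ) → 𝕜) α • w s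
  smul_of_pos : ∀ k α j, 0 < deg k → ι 𝕜 (g k α) • w j = 0

namespace IsExpPolynomialFamily

variable {J : Type*} [Fintype J] {w : J → M}

lemma prod_smul_mem_span_const (hw : IsExpPolynomialFamily 𝕜 deg g w)
    (hG : IsExtragraded 𝒢 𝒵 deg g) {l : List (ℤ × (Z → UniversalEnvelopingAlgebra 𝕜 G))}
    (hl : ∀ p ∈ l, p.2 ∈ familySpan E deg g p.1) (hsum : 0 ≤ (l.map Prod.fst).sum) {m : Z → M}
    (hm : m ∈ Submodule.span E (Set.range fun j => Function.const Z (w j))) :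
    (l.map Prod.snd).prod • m ∈ Submodule.span E (Set.range fun j => Function.const Z (w j)) := by
  let W := Submodule.span E (Set.range fun j => Function.const Z (w j))
  refine prod_smul_mem_of_sum_nonneg (W := W.toAddSubgroup) (L := fun i => familySpan E deg g i)
    hG.commutator_mem_familySpan (fun a ha m hm => ?_) (fun i hi a ha m hm => ?_) hl hsum hm
  · refine smul_mem_of_mem_familySpan (fun k hk A hA j => ?_) ha hm
    obtain ⟨h, hh⟩ := hw.smul_of_zero k hk j
    have hact : (fun z => ι 𝕜 (g k (A z)) • w j) =
        ∑ s, (⟨_, hA _ (h s).2⟩ : E) • Function.const Z (w s) := by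
      funext z
      rw [hh, Finset.sum_apply]
      rfl
    rw [hact]
    exact sum_mem fun s _ => Submodule.smul_mem _ _ (Submodule.subset_span ⟨s, rfl⟩)
  · exact (Submodule.mem_bot E).1 <| smul_mem_of_mem_familySpan
      (fun k hk A _ j => funext fun z => hw.smul_of_pos k (A z) j (hi.trans_eq hk.symm)) ha hm

lemma exists_wordProd_smul_eq (hw : IsExpPolynomialFamily 𝕜 deg g w)
    (hG : IsExtragraded 𝒢 𝒵 deg g) {l : List (K × (Z → Fin n → ℤ))}
    (hl : ∀ p ∈ l, PullsBackExpPolynomials E p.2) (hsum : 0 ≤ (l.map fun p => deg p.1).sum)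
    (j : J) : ∃ q : J → E, ∀ z, wordProd 𝕜 g (l.map fun p => (p.1, p.2 z)) • w j =
      ∑ s, (q s : Z → 𝕜) z • w s := by
  let word : List (ℤ × (Z → UniversalEnvelopingAlgebra 𝕜 G)) :=
    l.map fun p => (deg p.1, fun z => ι 𝕜 (g p.1 (p.2 z)))
  have hword : ∀ p ∈ word, p.2 ∈ familySpan E deg g p.1 :=
    List.forall_mem_map.2 fun p hp => Submodule.subset_span ⟨p.1, p.2, rfl, hl p hp, rfl⟩
  have hwordsum : 0 ≤ (word.map Prod.fst).sum := by
    simpa only [word, List.map_map, Function.comp_def] using hsum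
  obtain ⟨q, hq⟩ := (Submodule.mem_span_range_iff_exists_fun E).1 <|
    hw.prod_smul_mem_span_const hG hword hwordsum (Submodule.subset_span ⟨j, rfl⟩)
  refine ⟨q, fun z => ?_⟩
  have hz := congrFun hq z
  rw [Finset.sum_apply, Pi.smul_apply', Pi.list_prod_apply] at hz
  simp only [word, List.map_map, Function.comp_def] at hz
  rw [wordProd, List.map_map]
  exact hz.symm

lemma exists_wordProd_smul_wordProd_smul_eq (hw : IsExpPolynomialFamily 𝕜 deg g w)
    (hG : IsExtragraded 𝒢 𝒵 deg g) {κ κ' : List K}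
    (hsum : 0 ≤ (κ'.map deg).sum + (κ.map deg).sum) (j : J) :
    ∃ q : J → separableFunctions 𝕜 (ℕ → Fin n → ℤ) (ℕ → Fin n → ℤ), ∀ x y,
      wordProd 𝕜 g (wordOfShape κ' y) • wordProd 𝕜 g (wordOfShape κ x) • w j =
        ∑ s, (q s : _ → 𝕜) (x, y) • w s := by
  let X := ℕ → Fin n → ℤ
  let l : List (K × (X × X → Fin n → ℤ)) :=
    wordOfShape κ' (fun i z => z.2 i) ++ wordOfShape κ (fun i z => z.1 i)
  have hl : ∀ p ∈ l, PullsBackExpPolynomials (separableFunctions 𝕜 X X) p.2 := by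
    refine List.forall_mem_append.2 ⟨fun p hp => ?_, fun p hp => ?_⟩
    · obtain ⟨i, hi⟩ := exists_eq_of_mem_wordOfShape hp
      rw [hi]
      exact fun f _ => snd_mem_separableFunctions fun y : X => f (y i)
    · obtain ⟨i, hi⟩ := exists_eq_of_mem_wordOfShape hp
      rw [hi]
      exact fun f _ => fst_mem_separableFunctions fun x : X => f (x i)
  have hlsum : 0 ≤ (l.map fun p => deg p.1).sum := by
    have hmap : (l.map fun p => deg p.1) = (l.map Prod.fst).map deg := List.map_map.symm
    rwa [hmap, List.map_append, map_fst_wordOfShape, map_fst_wordOfShape, List.map_append,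
      List.sum_append]
  obtain ⟨q, hq⟩ := hw.exists_wordProd_smul_eq hG hl hlsum j
  refine ⟨q, fun x y => ?_⟩
  have hxy : l.map (Prod.map id fun F => F (x, y)) = wordOfShape κ' y ++ wordOfShape κ x := by
    rw [List.map_append, map_wordOfShape, map_wordOfShape]
    rfl
  rw [← mul_smul, ← wordProd_append, ← hxy]
  exact hq (x, y)

end IsExpPolynomialFamily

variable (𝕜 M) in
/-- The linear map taking `m` to the family `y ↦ wordOfShape κ y • m`. -/
noncomputable def actionOfShape {A : Type*} (g : K → A → G) (κ : List K) : M →ₗ[𝕜] (ℕ → A) → M :=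
  LinearMap.pi fun y => Algebra.lsmul 𝕜 𝕜 M (wordProd 𝕜 g (wordOfShape κ y))

lemma actionOfShape_apply {A : Type*} (g : K → A → G) (κ : List K) (m : M) (y : ℕ → A) :
    actionOfShape 𝕜 M g κ m y = wordProd 𝕜 g (wordOfShape κ y) • m :=
  rfl

end MatrixCoefficients

variable {V : Type*} [AddCommGroup V] [Module 𝕜 V] [LieRingModule 𝒵.zeroPart V]
  [LieModule 𝕜 𝒵.zeroPart V]

lemma IsExtragraded.eq_zero_of_forall_wordProd_smul (hG : IsExtragraded 𝒢 𝒵 deg g) {j : ℤ}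
    {m : MQuot 𝒵 V} (hm : m ∈ MQuotComp 𝒵 V j)
    (h : ∀ l : List (K × (Fin n → ℤ)), (∀ p ∈ l, 0 < deg p.1) →
      (l.map fun p => deg p.1).sum = -j → wordProd 𝕜 g l • m = 0) : m = 0 := by
  induction hr : (-j).toNat using Nat.strong_induction_on generalizing j m with
  | _ r ih =>
    obtain hj | rfl | hj := lt_trichotomy j 0
    · have hsing : m ∈ singularVectors 𝒵 V j := by
        refine ⟨hm, fun i hi x hx => ?_⟩
        have hle : 𝒵.comp i ≤ LinearMap.ker ((Algebra.lsmul 𝕜 𝕜 _).toLinearMap.flip m ∘ₗ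
            (ι 𝕜 : G →ₗ⁅𝕜⁆ _).toLinearMap) := by
          refine hG.comp_le ?_
          rintro k α rfl
          refine ih _ ?_ ((isModuleGrading_MQuotComp 𝒵 V).smul_mem (hG.mem_deg k α) hm)
            (fun l hl hsum => ?_) rfl
          · lia
          · rw [← h (l ++ [(k, α)]) (List.forall_mem_append.2 ⟨hl, by simpa using hi⟩)
              (by simp [hsum])]
            simp [wordProd, mul_smul]
        exact hle hx
      rwa [singularVectors_eq_bot hj] at hsing
    · simpa [wordProd] using h [] (by simp) (by simp)
    · rwa [MQuotComp_of_pos hj] at hm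

lemma IsExtragraded.wordProd_smul_mem_MQuotComp (hG : IsExtragraded 𝒢 𝒵 deg g)
    (l : List (K × (Fin n → ℤ))) {w : MQuot 𝒵 V} (hw : w ∈ MQuotComp 𝒵 V 0) :
    wordProd 𝕜 g l • w ∈ MQuotComp 𝒵 V (l.map fun p => deg p.1).sum := by
  have h := SetLike.GradedSMul.smul_mem (hG.wordProd_mem_envelopingComp l) hw
  rwa [vadd_eq_add, add_zero] at h

variable (V) in
lemma IsExtragraded.negWordSpan_eq (hG : IsExtragraded 𝒢 𝒵 deg g) :
    negWordSpan deg g (MQuotComp 𝒵 V 0) = MQuotComp 𝒵 V := by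
  refine eq_of_le_of_isInternal (isModuleGrading_MQuotComp 𝒵 V).isInternal
    (fun i => Submodule.span_le.2 ?_) (hG.iSup_negWordSpan
      (fun i hi x hx w hw => ι_smul_mem_MQuotComp_zero hi hx hw) (span_MQuotComp_zero 𝒵 V))
  rintro _ ⟨l, -, rfl, w, hw, rfl⟩
  exact hG.wordProd_smul_mem_MQuotComp l hw

lemma IsExpPolynomialFamily.fg_span_range_wordProd_smul {J : Type*} [Fintype J]
    {w : J → MQuot 𝒵 V} (hw : IsExpPolynomialFamily 𝕜 deg g w) (hG : IsExtragraded 𝒢 𝒵 deg g)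
    {j : J} (hwj : w j ∈ MQuotComp 𝒵 V 0) (κ : List K) :
    (Submodule.span 𝕜 (Set.range fun x : ℕ → Fin n → ℤ =>
      wordProd 𝕜 g (wordOfShape κ x) • w j)).FG := by
  let shapes := {κ' : List K | (∀ k ∈ κ', 0 < deg k) ∧ (κ'.map deg).sum = -(κ.map deg).sum}
  have : Finite shapes := finite_setOf_sum_eq hG.finite_deg _
  let T (κ' : shapes) := actionOfShape 𝕜 (MQuot 𝒵 V) g κ'.1
  refine fg_of_fg_map_of_inf_iInf_ker_eq_bot T (fun κ' => ?_) (eq_bot_iff.2 fun m hm => ?_)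
  · obtain ⟨q, hq⟩ := hw.exists_wordProd_smul_wordProd_smul_eq hG (κ := κ) (κ' := κ'.1)
      (by rw [κ'.2.2, neg_add_cancel]) j
    exact fg_map_span_range_of_separable (T κ') _ w (fun s => (q s).2) hq
  · have hle : Submodule.span 𝕜 (Set.range fun x : ℕ → Fin n → ℤ =>
        wordProd 𝕜 g (wordOfShape κ x) • w j) ≤ MQuotComp 𝒵 V (κ.map deg).sum := by
      refine Submodule.span_le.2 (Set.range_subset_iff.2 fun x => ?_)
      have hmem := hG.wordProd_smul_mem_MQuotComp (wordOfShape κ x) hwj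
      have hdeg := List.map_map (f := Prod.fst) (g := deg) (l := wordOfShape κ x)
      rw [map_fst_wordOfShape] at hdeg
      rwa [hdeg]
    refine hG.eq_zero_of_forall_wordProd_smul (hle hm.1) fun l hl hsum => ?_
    obtain ⟨y, hy⟩ := exists_wordOfShape_eq l
    have hker := (Submodule.mem_iInf _).1 hm.2
      ⟨l.map Prod.fst, List.forall_mem_map.2 hl, by rw [List.map_map]; exact hsum⟩
    have hzy := congrFun (LinearMap.mem_ker.1 hker) y
    rwa [Pi.zero_apply, actionOfShape_apply, hy] at hzy

lemma IsFiniteExpPolynomialModule.exists_span_eq_MQuotComp_zero {hG : IsExtragraded 𝒢 𝒵 deg g}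
    (hV : IsFiniteExpPolynomialModule 𝕜 V hG.zeroFamily) :
    ∃ (d : ℕ) (w : Fin d → MQuot 𝒵 V), Submodule.span 𝕜 (Set.range w) = MQuotComp 𝒵 V 0 ∧
      IsExpPolynomialFamily 𝕜 deg g w := by
  obtain ⟨d, v, h, hv⟩ := hV
  let π : V →ₗ[𝕜] MQuot 𝒵 V := (MTildeRad 𝒵 V).mkQ.restrictScalars 𝕜 ∘ₗ toMTilde 𝒵 V
  have hπ (u : UniversalEnvelopingAlgebra 𝕜 G) (x : V) :
      u • π x = (MTildeRad 𝒵 V).mkQ (u • toMTilde 𝒵 V x) :=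
    (map_smul (MTildeRad 𝒵 V).mkQ u (toMTilde 𝒵 V x)).symm
  refine ⟨d, π ∘ v, ?_, fun k hk j => ⟨h ⟨k, hk⟩ j, fun α => ?_⟩, fun k α j hk => ?_⟩
  · rw [Set.range_comp, ← Submodule.map_span, v.span_eq, Submodule.map_top, LinearMap.range_comp,
      ← MTildeComp_zero, MQuotComp]
  · have hmem : g k α ∈ 𝒵.comp 0 := hk ▸ hG.mem_deg k α
    have hact : ι 𝕜 (g k α) • π (v j) = π ⁅hG.zeroFamily ⟨k, hk⟩ α, v j⁆ := by
      rw [hπ, ι_smul_toMTilde ⟨g k α, 𝒵.mem_nonnegPart le_rfl hmem⟩, inflatedRep_of_mem_zero hmem]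
      rfl
    rw [Function.comp_apply, hact, hv, map_sum]
    exact Finset.sum_congr rfl fun s _ => map_smul _ _ _
  · rw [Function.comp_apply, hπ, ι_smul_toMTilde_eq_zero hk (hG.mem_deg k α), map_zero]

lemma IsExtragraded.finiteDimensional_MQuotComp (hG : IsExtragraded 𝒢 𝒵 deg g)
    (hV : IsFiniteExpPolynomialModule 𝕜 V hG.zeroFamily) (i : ℤ) :
    FiniteDimensional 𝕜 (MQuotComp 𝒵 V i) := by
  obtain ⟨d, w, hw, hfamily⟩ := hV.exists_span_eq_MQuotComp_zero
  have hshapes : Finite {κ : List K | (∀ k ∈ κ, deg k < 0) ∧ (κ.map deg).sum = i} := by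
    have hfin := finite_setOf_sum_eq (d := fun k => -deg k) (i := -i) fun m => by
      simpa [neg_eq_iff_eq_neg] using hG.finite_deg (-m)
    refine hfin.subset fun κ hκ => ⟨fun k hk => neg_pos.2 (hκ.1 k hk), ?_⟩
    rw [← hκ.2]
    simp [List.sum_neg, Function.comp_def]
  have hle := negWordSpan_span_le (𝕜 := 𝕜) (deg := deg) (g := g) w i
  rw [hw, hG.negWordSpan_eq V] at hle
  refine Module.Finite.iff_fg.2 (Submodule.FG.of_le ?_ hle)
  exact Submodule.fg_iSup _ fun κ => Submodule.fg_iSup _ fun j =>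
    hfamily.fg_span_range_wordProd_smul hG (hw ▸ Submodule.subset_span ⟨j, rfl⟩) κ.1

end SpanningFamily

end Modules

theorem theorem1p7_general {𝕜 G K V : Type*} [Field 𝕜] [LieRing G] [LieAlgebra 𝕜 G]
    {n : ℕ} (𝒢 : LieGrading 𝕜 G (Fin n → ℤ)) (𝒵 : LieGrading 𝕜 G ℤ)
    (deg : K → ℤ) (g : K → (Fin n → ℤ) → G) (hG : IsExtragraded 𝒢 𝒵 deg g)
    [AddCommGroup V] [Module 𝕜 V] [LieRingModule 𝒵.zeroPart V] [LieModule 𝕜 𝒵.zeroPart V]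
    (hV : IsFiniteExpPolynomialModule 𝕜 V hG.zeroFamily) :
    IsModuleGrading 𝒵 (MQuotComp 𝒵 V) ∧
      ∀ i : ℤ, FiniteDimensional 𝕜 (MQuotComp 𝒵 V i) :=
  ⟨isModuleGrading_MQuotComp 𝒵 V, hG.finiteDimensional_MQuotComp hV⟩

theorem theorem1p7 {𝕜 G K V : Type*} [Field 𝕜] [CharZero 𝕜] [LieRing G] [LieAlgebra 𝕜 G]
    {n : ℕ} (𝒢 : LieGrading 𝕜 G (Fin n → ℤ)) (𝒵 : LieGrading 𝕜 G ℤ)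
    (deg : K → ℤ) (g : K → (Fin n → ℤ) → G) (hG : IsExtragraded 𝒢 𝒵 deg g)
    [AddCommGroup V] [Module 𝕜 V] [LieRingModule 𝒵.zeroPart V] [LieModule 𝕜 𝒵.zeroPart V]
    (hV : IsFiniteExpPolynomialModule 𝕜 V hG.zeroFamily) :
    IsModuleGrading 𝒵 (MQuotComp 𝒵 V) ∧
      ∀ i : ℤ, FiniteDimensional 𝕜 (MQuotComp 𝒵 V i) :=
  theorem1p7_general 𝒢 𝒵 deg g hG hV
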